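/- **Setting.** Let $n\ge 1$, let $u,v,\mu\in\mathbb R$ with $\mu>0$, and put $\alpha=e^{-\mu}$, $x=e^{-v}$, $y=e^{-u}$. Let $I=\mathrm{diag}(\mathbf 1_n,-\mathbf 1_n)$, $K=\mathrm{SU}(2n)$, $K_+=\{k\in K: k^\dagger I k=I\}$, and let $B$ be the group of upper triangular elements of $\mathrm{SL}(2n,\mathbb C)$ with real positive diagonal entries. Every $g\in \mathrm{SL}(2n,\mathbb C)$ factorises uniquely as $g=k_Lb_R=b_Lk_R$ with $k_L,k_R\in K$, $b_L,b_R\in B$; set $L(g)=k_L^\dagger I k_L I$ and $\Phi_1(g)=\tfrac12\operatorname{tr}L(g)$. Fix $\hat v\in\mathbb C^n$ with $|\hat v|^2=\alpha^2(\alpha^{-2n}-1)$, put $\hat w=(\hat v,0)\in\mathbb C^{2n}$ and $w(g)=k_L^\dagger\hat w$, and let $\sigma$ be upper triangular with real positive diagonal entries and $\sigma\sigma^\dagger=\alpha^2\mathbf 1_n+\hat v\hat v^\dagger$. Let $$\mathcal M_0=\left\{g\in \mathrm{SL}(2n,\mathbb C)\ :\ b_R=\begin{pmatrix}x\mathbf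 1_n&*\\0&x^{-1}\mathbf 1_n\end{pmatrix},\ b_L=\begin{pmatrix}y^{-1}\sigma&*\\0&y\mathbf 1_n\end{pmatrix}\right\},\qquad \mathcal M_{\rm red}=\mathcal M_0/(K_+(\sigma)\times K_+),$$ where $(f,h)$ acts by $g\mapsto fgh^{\dagger}$, and $K_+(\sigma)$ is the product of $\{f\in K_+: f\hat w=\hat w\}$ and $\{\mathrm{diag}(\gamma\mathbf 1_n,\gamma^{-1}\mathbf 1_n):|\gamma|=1\}$. The function $\Phi_1$ is $(K_+\times K_+)$-invariant and descends to a function $\Phi_1^{\rm red}$ on $\mathcal M_{\rm red}$. **Coordinates.** A point $p\in\mathcal M_{\rm red}$ has coordinates $(\lambda,e^{i\theta})$, where $\lambda,\theta\in\mathbb R^n$, if $p$ is the orbit of some $g\in\mathcal M_0$ with the following properties. With $\Lambda_i=e^{2\lambda_i}$ one has $\Lambda_1>\dots>\Lambda_n>\max(x^2,x^{-2})$; the upper right block of $b_R$ is $\mathrm{diag}(\beta_1,\dots,\beta_n)$ with $\beta_i=[\Lambda_i+\Lambda_i^{-1}-x^2-x^{-2}]^{1/2}$; all components of the vector $\tilde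 w=\rho\, w(g)$ are non-zero, where $$\rho=\begin{pmatrix}\Gamma&\Sigma\\ \Sigma&-\Gamma\end{pmatrix},\qquad \Gamma=\mathrm{diag}\Bigl(\Bigl[\tfrac{\Lambda_i-x^{-2}}{\Lambda_i-\Lambda_i^{-1}}\Bigr]^{1/2}\Bigr),\qquad \Sigma=\mathrm{diag}\Bigl(\Bigl[\tfrac{x^{-2}-\Lambda_i^{-1}}{\Lambda_i-\Lambda_i^{-1}}\Bigr]^{1/2}\Bigr);$$ and $\tilde w_j^*\tilde w_{n+j}=|\tilde w_j\tilde w_{n+j}|e^{i\theta_j}$ for $j=1,\dots,n$. **Theorem.** Whenever $p\in\mathcal M_{\rm red}$ has coordinates $(\lambda,e^{i\theta})$, one has $\lambda_1>\dots>\lambda_n>\max(|u|,|v|)$ and $\lambda_i-\lambda_{i+1}>\mu$ for $1\le i\le n-1$ (so that all the expressions under the square roots below are positive), and $$\Phi_1^{\rm red}(p)=V(\lambda)+e^{v-u}\sum_{k=1}^n\frac{\cos\theta_k}{\cosh^2\lambda_k}\Bigl[1-\frac{\sinh^2v}{\sinh^2\lambda_k}\Bigr]^{1/2}\Bigl[1-\frac{\sinh^2u}{\sinh^2\lambda_k}\Bigr]^{1/2}\prod_{\substack{l=1\\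 l\ne k}}^n\Bigl[1-\frac{\sinh^2\mu}{\sinh^2(\lambda_k-\lambda_l)}\Bigr]^{1/2}\Bigl[1-\frac{\sinh^2\mu}{\sinh^2(\lambda_k+\lambda_l)}\Bigr]^{1/2},$$ where $$V(\lambda)=e^{v-u}\left(\frac{\sinh v\,\sinh u}{\sinh^2\mu}\prod_{k=1}^n\Bigl[1-\frac{\sinh^2\mu}{\sinh^2\lambda_k}\Bigr]-\frac{\cosh v\,\cosh u}{\sinh^2\mu}\prod_{k=1}^n\Bigl[1+\frac{\sinh^2\mu}{\cosh^2\lambda_k}\Bigr]+C\right),\qquad C=n\,e^{u-v}+\frac{\cosh(v-u)}{\sinh^2\mu}.$$ -/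

import Mathlib

namespace SU2n

open Matrix
open scoped ComplexOrder

section Triangular

/-- Upper triangular matrices (with respect to the order of the indices induced by `key`) whose
diagonal entries are real and positive. -/
def IsPosUpper {ι α : Type*} [LT α] (key : ι → α) (M : Matrix ι ι ℂ) : Prop :=
  M.BlockTriangular key ∧ ∀ i, 0 < (M i i).re ∧ (M i i).im = 0

theorem IsPosUpper.diag_pos {ι α : Type*} [LT α] {key : ι → α} {M : Matrix ι ι ℂ}
    (h : IsPosUpper key M) (i : ι) : 0 < M i i := by
  rw [Complex.lt_def]
  exact ⟨by simpa using (h.2 i).1, by simpa using (h.2 i).2.symm⟩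

theorem isPosUpper_of_pos {ι α : Type*} [LT α] {key : ι → α} {M : Matrix ι ι ℂ}
    (h : M.BlockTriangular key) (h2 : ∀ i, 0 < M i i) : IsPosUpper key M := by
  refine ⟨h, fun i => ?_⟩
  have := h2 i
  rw [Complex.lt_def] at this
  exact ⟨by simpa using this.1, by simpa using this.2.symm⟩

theorem diag_mul_of_triangular {ι : Type*} [LinearOrder ι] [Fintype ι] {M N : Matrix ι ι ℂ}
    (hM : M.BlockTriangular id) (hN : N.BlockTriangular id) (i : ι) :
    (M * N) i i = M i i * N i i := by
  rw [Matrix.mul_apply]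
  refine Finset.sum_eq_single i (fun j _ hj => ?_) (by simp)
  rcases lt_or_gt_of_ne hj with h | h
  · rw [hM h, zero_mul]
  · rw [hN h, mul_zero]

theorem IsPosUpper.mul {ι : Type*} [LinearOrder ι] [Fintype ι] {M N : Matrix ι ι ℂ}
    (hM : IsPosUpper id M) (hN : IsPosUpper id N) : IsPosUpper id (M * N) := by
  refine isPosUpper_of_pos (hM.1.mul hN.1) fun i => ?_
  rw [diag_mul_of_triangular hM.1 hN.1]
  exact mul_pos (hM.diag_pos i) (hN.diag_pos i)

theorem IsPosUpper.det_pos {ι : Type*} [LinearOrder ι] [Fintype ι] {M : Matrix ι ι ℂ}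
    (hM : IsPosUpper id M) : 0 < M.det := by
  rw [Matrix.det_of_isUpperTriangular hM.1]
  exact Finset.prod_pos fun i _ => hM.diag_pos i

theorem triangular_of_mul_eq_one {ι : Type*} [LinearOrder ι] [Fintype ι] {M N : Matrix ι ι ℂ}
    (hM : M.BlockTriangular id) (h : N * M = 1) : N.BlockTriangular id := by
  have : Invertible M := ⟨N, h, mul_eq_one_comm.1 h⟩
  rw [← Matrix.inv_eq_left_inv h]
  exact Matrix.blockTriangular_inv_of_blockTriangular hM

theorem IsPosUpper.of_mul_eq_one {ι : Type*} [LinearOrder ι] [Fintype ι] {M N : Matrix ι ι ℂ}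
    (hM : IsPosUpper id M) (h : N * M = 1) : IsPosUpper id N := by
  have hN := triangular_of_mul_eq_one hM.1 h
  refine isPosUpper_of_pos hN fun i => ?_
  have h1 := diag_mul_of_triangular hN hM.1 i
  rw [h, Matrix.one_apply_eq] at h1
  have h2 := hM.diag_pos i
  rw [eq_inv_of_mul_eq_one_left h1.symm]
  exact inv_pos.2 h2

/-- A unitary matrix that is upper triangular with positive diagonal is the identity. -/
theorem IsPosUpper.eq_one_of_unitary {ι : Type*} [LinearOrder ι] [Fintype ι] {M : Matrix ι ι ℂ}
    (hM : IsPosUpper id M) (h : Mᴴ * M = 1) : M = 1 := by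
  have hN := hM.of_mul_eq_one h
  have hoff : ∀ i j, i ≠ j → M i j = 0 := by
    intro i j hij
    rcases lt_or_gt_of_ne hij with h1 | h1
    · have := hN.1 h1
      simpa [Matrix.conjTranspose_apply] using this
    · exact hM.1 h1
  ext i j
  by_cases hij : i = j
  · subst hij
    have h1 := diag_mul_of_triangular hN.1 hM.1 i
    rw [h, Matrix.one_apply_eq, Matrix.conjTranspose_apply] at h1
    have h2 := hM.2 i
    have h3 : M i i = ((M i i).re : ℂ) := by
      apply Complex.ext <;> simp [h2.2]
    rw [h3] at h1 ⊢
    rw [Complex.star_def, Complex.conj_ofReal] at h1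
    have h4 : (M i i).re * (M i i).re = 1 := by exact_mod_cast h1.symm
    have h5 : (M i i).re = 1 := by nlinarith [h2.1]
    rw [h5]; simp
  · rw [hoff i j hij, Matrix.one_apply_ne hij]

/-- Gram--Schmidt orthogonalisation. -/
theorem exists_unitary_mul_posUpper {ι : Type*} [LinearOrder ι] [Fintype ι]
    [WellFoundedLT ι] [LocallyFiniteOrderBot ι] (g : Matrix ι ι ℂ) (hg : IsUnit g) :
    ∃ k b : Matrix ι ι ℂ, kᴴ * k = 1 ∧ IsPosUpper id b ∧ g = k * b := by
  have hS : (gᴴ * g).PosDef :=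
    Matrix.PosDef.conjTranspose_mul_self g
      (Matrix.mulVec_injective_iff_isUnit.2 hg)
  set X : Matrix ι ι ℂ := (LDL.lowerInv hS)ᴴ with hX
  have hXu : IsUnit X := by
    rw [hX, Matrix.isUnit_conjTranspose]
    exact isUnit_of_invertible _
  have hXt : X.BlockTriangular id := by
    intro i j hij
    exact (congrArg star (LDL.lowerInv_triangular hS (show j < i from hij))).trans (star_zero ℂ)
  have hD : Xᴴ * (gᴴ * g) * X = LDL.diag hS := by
    rw [LDL.diag_eq_lowerInv_conj, hX, Matrix.conjTranspose_conjTranspose]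
  have hDp : (LDL.diag hS).PosDef := by
    rw [← hD]
    exact hS.conjTranspose_mul_mul_same (Matrix.mulVec_injective_iff_isUnit.2 hXu)
  have hd : ∀ i, 0 < LDL.diagEntries hS i := by
    intro i
    have := hDp.diag_pos (i := i)
    simpa [LDL.diag] using this
  have hXd : ∀ i, X i i ≠ 0 := by
    have h1 : X.det ≠ 0 := ((Matrix.isUnit_iff_isUnit_det X).1 hXu).ne_zero
    rw [Matrix.det_of_isUpperTriangular hXt] at h1
    intro i
    exact Finset.prod_ne_zero_iff.1 h1 i (Finset.mem_univ i)
  choose d hd0 hd' using fun i => show ∃ d : ℝ, 0 < d ∧ LDL.diagEntries hS i = d from by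
    have := hd i
    rw [Complex.lt_def] at this
    refine ⟨(LDL.diagEntries hS i).re, by simpa using this.1, ?_⟩
    apply Complex.ext
    · simp
    · simpa using this.2.symm
  set e : ι → ℂ := fun i => star (X i i) / ((‖X i i‖ * Real.sqrt (d i) : ℝ) : ℂ) with he
  set Y : Matrix ι ι ℂ := X * diagonal e with hY
  have hYt : Y.BlockTriangular id := hXt.mul (Matrix.blockTriangular_diagonal e)
  have hYd : ∀ i, 0 < Y i i := by
    intro i
    have hn : 0 < ‖X i i‖ := norm_pos_iff.2 (hXd i)
    have hs : 0 < Real.sqrt (d i) := Real.sqrt_pos.2 (hd0 i)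
    have : Y i i = ((‖X i i‖ / Real.sqrt (d i) : ℝ) : ℂ) := by
      rw [hY, Matrix.mul_diagonal, he]
      simp only
      rw [← mul_div_assoc, Complex.star_def, Complex.mul_conj, Complex.normSq_eq_norm_sq,
        ← Complex.ofReal_div]
      congr 1
      field_simp
    rw [this]
    exact_mod_cast div_pos hn hs
  have hYp : IsPosUpper id Y := isPosUpper_of_pos hYt hYd
  have hYdet : IsUnit Y.det := isUnit_iff_ne_zero.2 hYp.det_pos.ne'
  refine ⟨g * Y, Y⁻¹, ?_, ?_, ?_⟩
  · have : (g * Y)ᴴ * (g * Y) = diagonal (star e) * (Xᴴ * (gᴴ * g) * X) * diagonal e := by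
      rw [hY]
      simp only [Matrix.conjTranspose_mul, Matrix.diagonal_conjTranspose, Matrix.mul_assoc]
    rw [this, hD, LDL.diag, Matrix.diagonal_mul_diagonal, Matrix.diagonal_mul_diagonal,
      ← Matrix.diagonal_one]
    congr 1
    funext i
    have hn : 0 < ‖X i i‖ := norm_pos_iff.2 (hXd i)
    have hs : 0 < Real.sqrt (d i) := Real.sqrt_pos.2 (hd0 i)
    have h1 : star (e i) * e i = (((d i)⁻¹ : ℝ) : ℂ) := by
      rw [Complex.star_def, mul_comm, Complex.mul_conj, Complex.normSq_eq_norm_sq, he]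
      simp only [norm_div, norm_star, Complex.norm_real, norm_mul, Real.norm_eq_abs]
      congr 1
      rw [abs_of_pos (by positivity), abs_of_pos (by positivity)]
      field_simp
      rw [Real.sq_sqrt (hd0 i).le, div_self (hd0 i).ne']
    rw [Pi.star_apply, mul_right_comm, h1, hd' i, ← Complex.ofReal_mul,
      inv_mul_cancel₀ (hd0 i).ne', Complex.ofReal_one]
  · exact hYp.of_mul_eq_one (Matrix.nonsing_inv_mul _ hYdet)
  · rw [Matrix.mul_assoc, Matrix.mul_nonsing_inv _ hYdet, Matrix.mul_one]

end Triangular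

section Phase

/-- Row and column indices of `2n × 2n` matrices, in `n × n` blocks; the indices of the first
block precede those of the second. -/
abbrev Idx (n : ℕ) : Type := Fin n ⊕ Fin n

/-- The order of the `2n` indices: first block before second block. -/
def idxKey (n : ℕ) : Idx n → Fin n ⊕ₗ Fin n := fun a => toLex a

/-- The master phase space `SL(2n, ℂ)`. -/
abbrev Phase (n : ℕ) : Type := Matrix.SpecialLinearGroup (Idx n) ℂ

/-- The underlying matrix. -/
def mat {n : ℕ} (g : Phase n) : Matrix (Idx n) (Idx n) ℂ := g

theorem mat_mul {n : ℕ} (g h : Phase n) : mat (g * h) = mat g * mat h := rfl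

theorem mat_one {n : ℕ} : mat (1 : Phase n) = 1 := rfl

theorem det_mat {n : ℕ} (g : Phase n) : (mat g).det = 1 := g.2

theorem mat_injective {n : ℕ} {g h : Phase n} (H : mat g = mat h) : g = h := Subtype.ext H

/-- The matrix `I = diag(1ₙ, -1ₙ)`. -/
def matI (n : ℕ) : Matrix (Idx n) (Idx n) ℂ := fromBlocks 1 0 0 (-1)

theorem mat_inv_mul {n : ℕ} (g : Phase n) : mat g⁻¹ * mat g = 1 := by
  rw [← mat_mul, inv_mul_cancel, mat_one]

theorem mat_mul_inv {n : ℕ} (g : Phase n) : mat g * mat g⁻¹ = 1 := by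
  rw [← mat_mul, mul_inv_cancel, mat_one]

/-- The group `K = SU(2n)`. -/
def grpK (n : ℕ) : Subgroup (Phase n) where
  carrier := {g | (mat g)ᴴ * mat g = 1}
  one_mem' := by simp [mat_one]
  mul_mem' := by
    intro a b ha hb
    change (mat a)ᴴ * mat a = 1 at ha
    change (mat b)ᴴ * mat b = 1 at hb
    change (mat (a * b))ᴴ * mat (a * b) = 1
    rw [mat_mul, conjTranspose_mul, Matrix.mul_assoc, ← Matrix.mul_assoc _ (mat a), ha,
      Matrix.one_mul, hb]
  inv_mem' := by
    intro a ha
    change (mat a)ᴴ * mat a = 1 at ha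
    change (mat a⁻¹)ᴴ * mat a⁻¹ = 1
    have h1 : mat a⁻¹ = (mat a)ᴴ := (left_inv_eq_right_inv ha (mat_mul_inv a)).symm
    rw [h1, conjTranspose_conjTranspose, ← h1]
    exact mat_mul_inv a

theorem mat_inv_of_mem_grpK {n : ℕ} {k : Phase n} (hk : k ∈ grpK n) : mat k⁻¹ = (mat k)ᴴ :=
  (left_inv_eq_right_inv hk (mat_mul_inv k)).symm

/-- Membership in the group `B` of upper triangular elements of `SL(2n, ℂ)` with real, positive
diagonal entries. -/
def IsB {n : ℕ} (b : Phase n) : Prop := IsPosUpper (idxKey n) (mat b)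

/-- Relabelling of a matrix by the linearly ordered set of indices. -/
def relabel {n : ℕ} (M : Matrix (Idx n) (Idx n) ℂ) :
    Matrix (Fin n ⊕ₗ Fin n) (Fin n ⊕ₗ Fin n) ℂ := M.submatrix ofLex ofLex

theorem relabel_injective {n : ℕ} {M N : Matrix (Idx n) (Idx n) ℂ} (h : relabel M = relabel N) :
    M = N := by
  ext i j
  exact congrFun (congrFun h (toLex i)) (toLex j)

theorem relabel_mul {n : ℕ} (M N : Matrix (Idx n) (Idx n) ℂ) :
    relabel (M * N) = relabel M * relabel N :=
  (Matrix.submatrix_mul_equiv M N (ofLex : Fin n ⊕ₗ Fin n → Idx n) ofLex ofLex).symm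

theorem relabel_one {n : ℕ} : relabel (1 : Matrix (Idx n) (Idx n) ℂ) = 1 := by
  rw [relabel, Matrix.submatrix_one_equiv (ofLex : Fin n ⊕ₗ Fin n ≃ Idx n)]

theorem relabel_conjTranspose {n : ℕ} (M : Matrix (Idx n) (Idx n) ℂ) :
    relabel Mᴴ = (relabel M)ᴴ := rfl

theorem isB_iff {n : ℕ} (b : Phase n) : IsB b ↔ IsPosUpper id (relabel (mat b)) := by
  constructor
  · exact fun h => ⟨fun i j hij => h.1 (i := ofLex i) (j := ofLex j) hij, fun i => h.2 (ofLex i)⟩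
  · exact fun h => ⟨fun i j hij => h.1 (i := toLex i) (j := toLex j) hij, fun i => h.2 (toLex i)⟩

theorem IsB.mul {n : ℕ} {a b : Phase n} (ha : IsB a) (hb : IsB b) : IsB (a * b) := by
  rw [isB_iff] at *
  rw [mat_mul, relabel_mul]
  exact ha.mul hb

theorem IsB.inv {n : ℕ} {b : Phase n} (hb : IsB b) : IsB b⁻¹ := by
  rw [isB_iff] at *
  refine hb.of_mul_eq_one ?_
  rw [← relabel_mul, mat_inv_mul, relabel_one]
  congr!

theorem eq_one_of_isB_of_mem_grpK {n : ℕ} {g : Phase n} (hb : IsB g) (hk : g ∈ grpK n) :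
    g = 1 := by
  rw [isB_iff] at hb
  apply mat_injective
  apply relabel_injective
  rw [mat_one, relabel_one]
  convert hb.eq_one_of_unitary ?_
  rw [← relabel_conjTranspose, ← relabel_mul, show (mat g)ᴴ * mat g = 1 from hk, relabel_one]
  congr!

/-- Every `g ∈ SL(2n, ℂ)` has a factorisation `g = k b` with `k ∈ K`, `b ∈ B`. -/
theorem exists_left_factor {n : ℕ} (g : Phase n) :
    ∃ k b : Phase n, k ∈ grpK n ∧ IsB b ∧ g = k * b := by
  have hu : IsUnit (relabel (mat g)) := by
    refine ⟨⟨relabel (mat g), relabel (mat g⁻¹), ?_, ?_⟩, rfl⟩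
    · rw [← relabel_mul, mat_mul_inv, relabel_one]
    · rw [← relabel_mul, mat_inv_mul, relabel_one]
  obtain ⟨k, b, hk, hb, h⟩ := exists_unitary_mul_posUpper (relabel (mat g)) hu
  have hdg : (relabel (mat g)).det = 1 := by
    rw [← det_mat g, relabel]
    convert Matrix.det_submatrix_equiv_self (ofLex : Fin n ⊕ₗ Fin n ≃ Idx n) (mat g)
  have hdb0 : 0 < b.det := by
    convert hb.det_pos
  have hk1 : kᴴ * k = 1 := by
    convert hk
  have hdk : ‖k.det‖ = 1 := by
    have h1 := congrArg Matrix.det hk1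
    rw [Matrix.det_mul, Matrix.det_conjTranspose, Matrix.det_one, Complex.star_def,
      Complex.conj_mul'] at h1
    have h2 : ‖k.det‖ ^ 2 = 1 := by exact_mod_cast h1
    nlinarith [norm_nonneg k.det]
  have hprod : k.det * b.det = 1 := by
    rw [← Matrix.det_mul, ← h, ← hdg]
  have hdb : b.det = 1 := by
    have h2 : ‖b.det‖ = 1 := by
      have := congrArg norm hprod
      rwa [norm_mul, hdk, one_mul, norm_one] at this
    rw [Complex.eq_coe_norm_of_nonneg hdb0.le, h2, Complex.ofReal_one]
  have hdk' : k.det = 1 := by rwa [hdb, mul_one] at hprod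
  have hdet : ∀ M : Matrix (Fin n ⊕ₗ Fin n) (Fin n ⊕ₗ Fin n) ℂ,
      (M.submatrix (toLex : Idx n ≃ Fin n ⊕ₗ Fin n) toLex).det = M.det := fun M =>
    Matrix.det_submatrix_equiv_self (toLex : Idx n ≃ Fin n ⊕ₗ Fin n) M
  obtain ⟨k', hk'⟩ : ∃ k' : Phase n, relabel (mat k') = k :=
    ⟨⟨k.submatrix (toLex : Idx n ≃ Fin n ⊕ₗ Fin n) toLex, (hdet k).trans hdk'⟩, rfl⟩
  obtain ⟨b', hb'⟩ : ∃ b' : Phase n, relabel (mat b') = b :=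
    ⟨⟨b.submatrix (toLex : Idx n ≃ Fin n ⊕ₗ Fin n) toLex, (hdet b).trans hdb⟩, rfl⟩
  refine ⟨k', b', ?_, ?_, ?_⟩
  · apply relabel_injective
    rw [relabel_mul, relabel_conjTranspose, relabel_one, hk', hk1]
  · rw [isB_iff, hb']
    exact hb
  · apply mat_injective
    apply relabel_injective
    rw [mat_mul, relabel_mul, hk', hb', h]

/-- The factors in `g = k b` are unique. -/
theorem left_factor_unique {n : ℕ} {k b k' b' : Phase n} (hk : k ∈ grpK n) (hb : IsB b)
    (hk' : k' ∈ grpK n) (hb' : IsB b') (h : k * b = k' * b') : k = k' ∧ b = b' := by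
  have h1 : k'⁻¹ * k = b' * b⁻¹ := by
    rw [inv_mul_eq_iff_eq_mul, ← mul_assoc, ← h, mul_assoc, mul_inv_cancel, mul_one]
  have h2 : k'⁻¹ * k = 1 :=
    eq_one_of_isB_of_mem_grpK (h1 ▸ hb'.mul hb.inv) ((grpK n).mul_mem ((grpK n).inv_mem hk') hk)
  have h3 : k = k' := (inv_mul_eq_one.1 h2).symm
  subst h3
  exact ⟨rfl, mul_left_cancel h⟩

/-- Every `g ∈ SL(2n, ℂ)` has a factorisation `g = b k` with `k ∈ K`, `b ∈ B`. -/
theorem exists_right_factor {n : ℕ} (g : Phase n) :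
    ∃ b k : Phase n, IsB b ∧ k ∈ grpK n ∧ g = b * k := by
  obtain ⟨k, b, hk, hb, h⟩ := exists_left_factor g⁻¹
  refine ⟨b⁻¹, k⁻¹, hb.inv, (grpK n).inv_mem hk, ?_⟩
  rw [← _root_.mul_inv_rev, ← h, inv_inv]

/-- The factors in `g = b k` are unique. -/
theorem right_factor_unique {n : ℕ} {k b k' b' : Phase n} (hb : IsB b) (hk : k ∈ grpK n)
    (hb' : IsB b') (hk' : k' ∈ grpK n) (h : b * k = b' * k') : b = b' ∧ k = k' := by
  have h1 : k⁻¹ * b⁻¹ = k'⁻¹ * b'⁻¹ := by rw [← _root_.mul_inv_rev, h, _root_.mul_inv_rev]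
  have := left_factor_unique ((grpK n).inv_mem hk) hb.inv ((grpK n).inv_mem hk') hb'.inv h1
  exact ⟨inv_injective this.2, inv_injective this.1⟩

end Phase

section Reduction

/-- The left `K`-factor `k_L` of `g = k_L b_R`. -/
noncomputable def kL {n : ℕ} (g : Phase n) : Phase n := (exists_left_factor g).choose

/-- The right `B`-factor `b_R` of `g = k_L b_R`. -/
noncomputable def bR {n : ℕ} (g : Phase n) : Phase n := (exists_left_factor g).choose_spec.choose

/-- The left `B`-factor `b_L` of `g = b_L k_R`. -/
noncomputable def bL {n : ℕ} (g : Phase n) : Phase n := (exists_right_factor g).choose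

theorem kL_mem {n : ℕ} (g : Phase n) : kL g ∈ grpK n :=
  (exists_left_factor g).choose_spec.choose_spec.1

theorem isB_bR {n : ℕ} (g : Phase n) : IsB (bR g) :=
  (exists_left_factor g).choose_spec.choose_spec.2.1

theorem kL_mul_bR {n : ℕ} (g : Phase n) : kL g * bR g = g :=
  (exists_left_factor g).choose_spec.choose_spec.2.2.symm

theorem isB_bL {n : ℕ} (g : Phase n) : IsB (bL g) :=
  (exists_right_factor g).choose_spec.choose_spec.1

theorem exists_bL_mul {n : ℕ} (g : Phase n) : ∃ k ∈ grpK n, bL g * k = g :=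
  ⟨_, (exists_right_factor g).choose_spec.choose_spec.2.1,
    (exists_right_factor g).choose_spec.choose_spec.2.2.symm⟩

theorem kL_eq {n : ℕ} {k b : Phase n} (hk : k ∈ grpK n) (hb : IsB b) : kL (k * b) = k :=
  (left_factor_unique (kL_mem _) (isB_bR _) hk hb (kL_mul_bR _)).1

/-- The matrix-valued function `L(g) = k† I k I`, where `g = k b`. -/
noncomputable def matL {n : ℕ} (g : Phase n) : Matrix (Idx n) (Idx n) ℂ :=
  (mat (kL g))ᴴ * matI n * mat (kL g) * matI n

/-- The free Hamiltonians `Φ_l = (1 / 2l) tr L^l`. -/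
noncomputable def Phi {n : ℕ} (l : ℕ) (g : Phase n) : ℂ :=
  1 / (2 * (l : ℂ)) * (matL g ^ l).trace

/-- The group `K₊ = {k ∈ K | k† I k = I}`. -/
def grpKPlus (n : ℕ) : Subgroup (Phase n) where
  carrier := {k | k ∈ grpK n ∧ (mat k)ᴴ * matI n * mat k = matI n}
  one_mem' := ⟨(grpK n).one_mem, by simp [mat_one]⟩
  mul_mem' := by
    rintro a b ⟨ha, ha'⟩ ⟨hb, hb'⟩
    refine ⟨(grpK n).mul_mem ha hb, ?_⟩
    rw [mat_mul, conjTranspose_mul]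
    calc (mat b)ᴴ * (mat a)ᴴ * matI n * (mat a * mat b)
        = (mat b)ᴴ * ((mat a)ᴴ * matI n * mat a) * mat b := by simp only [Matrix.mul_assoc]
      _ = matI n := by rw [ha', hb']
  inv_mem' := by
    rintro a ⟨ha, ha'⟩
    refine ⟨(grpK n).inv_mem ha, ?_⟩
    have h1 := mat_inv_of_mem_grpK ha
    have h2 : mat a * (mat a)ᴴ = 1 := by rw [← h1, mat_mul_inv]
    rw [h1, conjTranspose_conjTranspose]
    calc mat a * matI n * (mat a)ᴴ
        = mat a * ((mat a)ᴴ * matI n * mat a) * (mat a)ᴴ := by rw [ha']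
      _ = (mat a * (mat a)ᴴ) * matI n * (mat a * (mat a)ᴴ) := by simp only [Matrix.mul_assoc]
      _ = matI n := by rw [h2, Matrix.one_mul, Matrix.mul_one]

/-- The vector `ŵ = (v̂, 0)`. -/
def wHat {n : ℕ} (vhat : Fin n → ℂ) : Idx n → ℂ := Sum.elim vhat 0

/-- The map `w(g) = k† ŵ`, where `g = k b`. -/
noncomputable def wMap {n : ℕ} (vhat : Fin n → ℂ) (g : Phase n) : Idx n → ℂ :=
  (mat (kL g))ᴴ *ᵥ wHat vhat

/-- The group `K₊(ŵ)`, the stabiliser of `ŵ` in `K₊`. -/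
def stabKPlus {n : ℕ} (vhat : Fin n → ℂ) : Subgroup (Phase n) where
  carrier := {f | f ∈ grpKPlus n ∧ mat f *ᵥ wHat vhat = wHat vhat}
  one_mem' := ⟨(grpKPlus n).one_mem, by simp [mat_one]⟩
  mul_mem' := by
    rintro a b ⟨ha, ha'⟩ ⟨hb, hb'⟩
    exact ⟨(grpKPlus n).mul_mem ha hb, by rw [mat_mul, ← Matrix.mulVec_mulVec, hb', ha']⟩
  inv_mem' := by
    rintro a ⟨ha, ha'⟩
    refine ⟨(grpKPlus n).inv_mem ha, ?_⟩
    conv_lhs => rw [← ha']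
    rw [Matrix.mulVec_mulVec, mat_inv_mul, Matrix.one_mulVec]

/-- The one-dimensional torus `𝕋₁` of the matrices `diag(γ 1ₙ, γ⁻¹ 1ₙ)`, `γ ∈ U(1)`. -/
def torus1 (n : ℕ) : Subgroup (Phase n) where
  carrier := {f | ∃ γ : ℂ, ‖γ‖ = 1 ∧
    mat f = fromBlocks (γ • (1 : Matrix (Fin n) (Fin n) ℂ)) 0 0 (γ⁻¹ • 1)}
  one_mem' := ⟨1, by simp, by simp [mat_one]⟩
  mul_mem' := by
    rintro a b ⟨γ, hγ, ha⟩ ⟨δ, hδ, hb⟩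
    refine ⟨γ * δ, by rw [norm_mul, hγ, hδ, one_mul], ?_⟩
    rw [mat_mul, ha, hb, fromBlocks_multiply]
    simp [smul_smul, mul_comm]
  inv_mem' := by
    rintro a ⟨γ, hγ, ha⟩
    have h0 : γ ≠ 0 := fun h => by simp [h] at hγ
    refine ⟨γ⁻¹, by rw [norm_inv, hγ, inv_one], ?_⟩
    refine left_inv_eq_right_inv (mat_inv_mul a) ?_
    rw [ha, fromBlocks_multiply]
    simp [smul_smul, h0]

/-- The left-handed part `K₊(σ) = K₊(ŵ) × 𝕋₁` of the isotropy group: the (commuting) product of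
the two subgroups. -/
def leftGauge {n : ℕ} (vhat : Fin n → ℂ) : Subgroup (Phase n) := stabKPlus vhat ⊔ torus1 n

theorem torus1_le {n : ℕ} : torus1 n ≤ grpKPlus n := by
  rintro a ⟨γ, hγ, ha⟩
  have h1 : star γ * γ = 1 := by
    rw [Complex.star_def, Complex.conj_mul', hγ]; simp
  have h2 : star γ⁻¹ * γ⁻¹ = 1 := by
    rw [star_inv₀, ← mul_inv, h1, inv_one]
  have h1' : γ * star γ = 1 := by rw [mul_comm, h1]
  have h2' : γ⁻¹ * star γ⁻¹ = 1 := by rw [mul_comm, h2]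
  refine ⟨?_, ?_⟩
  · change (mat a)ᴴ * mat a = 1
    rw [ha, fromBlocks_conjTranspose, fromBlocks_multiply]
    simp only [conjTranspose_smul, conjTranspose_one, conjTranspose_zero, Matrix.mul_smul,
      smul_smul, h1', h2', Matrix.mul_one, Matrix.mul_zero,
      add_zero, zero_add, one_smul, fromBlocks_one, smul_zero]
  · rw [ha, fromBlocks_conjTranspose, matI, fromBlocks_multiply, fromBlocks_multiply]
    simp only [conjTranspose_smul, conjTranspose_one, conjTranspose_zero, Matrix.mul_smul,
      smul_smul, h1', h2', Matrix.mul_one, Matrix.mul_zero,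
      add_zero, zero_add, one_smul, smul_zero, Matrix.mul_neg, neg_zero, smul_neg]

theorem leftGauge_le {n : ℕ} (vhat : Fin n → ℂ) : leftGauge vhat ≤ grpKPlus n :=
  sup_le (fun _ h => h.1) torus1_le

theorem commute_of_mem_grpKPlus {n : ℕ} {k : Phase n} (hk : k ∈ grpKPlus n) :
    mat k * matI n = matI n * mat k := by
  have h1 := mat_inv_of_mem_grpK hk.1
  have h2 : mat k * (mat k)ᴴ = 1 := by rw [← h1, mat_mul_inv]
  calc mat k * matI n = mat k * ((mat k)ᴴ * matI n * mat k) := by rw [hk.2]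
    _ = (mat k * (mat k)ᴴ) * matI n * mat k := by simp only [Matrix.mul_assoc]
    _ = matI n * mat k := by rw [h2, Matrix.one_mul]

theorem lower_block_mul {n : ℕ} {M N : Matrix (Idx n) (Idx n) ℂ}
    (hM : ∀ i j, M (Sum.inr i) (Sum.inl j) = 0) (hN : ∀ i j, N (Sum.inr i) (Sum.inl j) = 0)
    (i j : Fin n) : (M * N) (Sum.inr i) (Sum.inl j) = 0 := by
  rw [Matrix.mul_apply, Fintype.sum_sum_type]
  simp [hM, hN]

theorem IsB.lower_block {n : ℕ} {b : Phase n} (hb : IsB b) (i j : Fin n) :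
    mat b (Sum.inr i) (Sum.inl j) = 0 :=
  hb.1 (Sum.Lex.inl_lt_inr j i)

theorem lower_block_of_mem_grpKPlus {n : ℕ} {k : Phase n} (hk : k ∈ grpKPlus n) (i j : Fin n) :
    mat k (Sum.inr i) (Sum.inl j) = 0 := by
  have h := congrFun (congrFun (commute_of_mem_grpKPlus hk) (Sum.inr i)) (Sum.inl j)
  simp only [matI, Matrix.mul_apply, Fintype.sum_sum_type, fromBlocks_apply₁₁,
    fromBlocks_apply₂₁, fromBlocks_apply₂₂, Matrix.one_apply, Matrix.zero_apply,
    Matrix.neg_apply] at h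
  simp at h
  exact self_eq_neg.1 h

/-- If `b f⁻¹ = k b'` with `f ∈ K₊`, `b, b' ∈ B`, `k ∈ K`, then `k ∈ K₊`. -/
theorem dressing_mem {n : ℕ} {b f k b' : Phase n} (hb : IsB b) (hf : f ∈ grpKPlus n)
    (hk : k ∈ grpK n) (hb' : IsB b') (h : b * f⁻¹ = k * b') : k ∈ grpKPlus n := by
  have e1 : k = b * f⁻¹ * b'⁻¹ := by rw [h, mul_assoc, mul_inv_cancel, mul_one]
  have e2 : k⁻¹ = b' * f * b⁻¹ := by
    rw [e1, _root_.mul_inv_rev, _root_.mul_inv_rev, inv_inv, inv_inv, mul_assoc]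
  have h1 : ∀ i j, mat k (Sum.inr i) (Sum.inl j) = 0 := by
    rw [e1, mat_mul, mat_mul]
    exact lower_block_mul (lower_block_mul hb.lower_block
      (lower_block_of_mem_grpKPlus ((grpKPlus n).inv_mem hf))) hb'.inv.lower_block
  have h2 : ∀ i j, mat k⁻¹ (Sum.inr i) (Sum.inl j) = 0 := by
    rw [e2, mat_mul, mat_mul]
    exact lower_block_mul (lower_block_mul hb'.lower_block
      (lower_block_of_mem_grpKPlus hf)) hb.inv.lower_block
  rw [mat_inv_of_mem_grpK hk] at h2
  have h3 : mat k = fromBlocks (mat k).toBlocks₁₁ 0 0 (mat k).toBlocks₂₂ := by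
    ext (i | i) (j | j)
    · rfl
    · have := h2 j i
      rw [Matrix.conjTranspose_apply] at this
      simpa using this
    · simpa using h1 i j
    · rfl
  refine ⟨hk, ?_⟩
  have h4 : matI n * mat k = mat k * matI n := by
    rw [h3, matI, fromBlocks_multiply, fromBlocks_multiply]
    simp
  rw [Matrix.mul_assoc, h4, ← Matrix.mul_assoc, show (mat k)ᴴ * mat k = 1 from hk, Matrix.one_mul]

theorem Phi_invariant {n : ℕ} (l : ℕ) {f h : Phase n} (g : Phase n) (hf : f ∈ grpKPlus n)
    (hh : h ∈ grpKPlus n) : Phi l (f * g * h⁻¹) = Phi l g := by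
  obtain ⟨k, b, hk, hb, e⟩ := exists_left_factor (bR g * h⁻¹)
  have hkp := dressing_mem (isB_bR g) hh hk hb e
  have e1 : kL (f * g * h⁻¹) = f * kL g * k := by
    have : f * g * h⁻¹ = (f * kL g * k) * b := by
      rw [mul_assoc (f * kL g), ← e]
      conv_lhs => rw [← kL_mul_bR g]
      simp only [mul_assoc]
    rw [this]
    exact kL_eq ((grpK n).mul_mem ((grpK n).mul_mem hf.1 (kL_mem g)) hk) hb
  have e2 : matL (f * g * h⁻¹) = mat k⁻¹ * matL g * mat k := by
    rw [matL, e1, mat_mul, mat_mul, conjTranspose_mul, conjTranspose_mul, mat_inv_of_mem_grpK hk,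
      matL]
    calc (mat k)ᴴ * ((mat (kL g))ᴴ * (mat f)ᴴ) * matI n * (mat f * mat (kL g) * mat k) * matI n
        = (mat k)ᴴ * (mat (kL g))ᴴ * ((mat f)ᴴ * matI n * mat f) * mat (kL g) *
          (mat k * matI n) := by simp only [Matrix.mul_assoc]
      _ = (mat k)ᴴ * ((mat (kL g))ᴴ * matI n * mat (kL g) * matI n) * mat k := by
        rw [hf.2, commute_of_mem_grpKPlus hkp]; simp only [Matrix.mul_assoc]
  have e3 : ∀ m : ℕ, matL (f * g * h⁻¹) ^ m = mat k⁻¹ * matL g ^ m * mat k := by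
    intro m
    induction m with
    | zero => simp [mat_inv_mul]
    | succ m ih =>
      rw [pow_succ, ih, e2, pow_succ]
      calc mat k⁻¹ * matL g ^ m * mat k * (mat k⁻¹ * matL g * mat k)
          = mat k⁻¹ * matL g ^ m * (mat k * mat k⁻¹) * matL g * mat k := by
            simp only [Matrix.mul_assoc]
        _ = mat k⁻¹ * (matL g ^ m * matL g) * mat k := by
            rw [mat_mul_inv, Matrix.mul_one]; simp only [Matrix.mul_assoc]
  rw [Phi, Phi, e3, Matrix.trace_mul_comm, ← Matrix.mul_assoc, mat_mul_inv, Matrix.one_mul]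

/-- The constraint surface `𝓜₀`: the diagonal blocks of `b_R` are `x 1ₙ`, `x⁻¹ 1ₙ`, and those of
`b_L` are `y⁻¹ σ`, `y 1ₙ`. -/
def M0 {n : ℕ} (x y : ℝ) (σ : Matrix (Fin n) (Fin n) ℂ) : Set (Phase n) :=
  {g | (mat (bR g)).toBlocks₁₁ = (x : ℂ) • (1 : Matrix (Fin n) (Fin n) ℂ) ∧
    (mat (bR g)).toBlocks₂₂ = (x : ℂ)⁻¹ • (1 : Matrix (Fin n) (Fin n) ℂ) ∧
    (mat (bL g)).toBlocks₁₁ = (y : ℂ)⁻¹ • σ ∧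
    (mat (bL g)).toBlocks₂₂ = (y : ℂ) • (1 : Matrix (Fin n) (Fin n) ℂ)}

/-- Two points of `𝓜₀` are gauge equivalent if they are in the same orbit of
`K₊(σ) × K₊`, where `(f, h)` acts by `g ↦ f g h†`. -/
def gaugeSetoid {n : ℕ} (x y : ℝ) (σ : Matrix (Fin n) (Fin n) ℂ) (vhat : Fin n → ℂ) :
    Setoid (M0 x y σ) where
  r g g' := ∃ f ∈ leftGauge vhat, ∃ h ∈ grpKPlus n, (g' : Phase n) = f * (g : Phase n) * h⁻¹
  iseqv :=
    { refl := fun g => ⟨1, one_mem _, 1, one_mem _, by simp⟩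
      symm := by
        rintro g g' ⟨f, hf, h, hh, e⟩
        refine ⟨f⁻¹, inv_mem hf, h⁻¹, inv_mem hh, ?_⟩
        rw [e]; group
      trans := by
        rintro g g' g'' ⟨f, hf, h, hh, e⟩ ⟨f', hf', h', hh', e'⟩
        refine ⟨f' * f, mul_mem hf' hf, h' * h, mul_mem hh' hh, ?_⟩
        rw [e', e]; group }

/-- The reduced phase space `𝓜_red = 𝓜₀ / (K₊(σ) × K₊)`. -/
def MRed {n : ℕ} (x y : ℝ) (σ : Matrix (Fin n) (Fin n) ℂ) (vhat : Fin n → ℂ) : Type :=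
  Quotient (gaugeSetoid x y σ vhat)

/-- The gauge orbit of a point of the constraint surface. -/
def orbit {n : ℕ} {x y : ℝ} {σ : Matrix (Fin n) (Fin n) ℂ} (vhat : Fin n → ℂ) (g : M0 x y σ) :
    MRed x y σ vhat := Quotient.mk (gaugeSetoid x y σ vhat) g

/-- The reduced Hamiltonians `Φ_l^red`: the functions on `𝓜_red` to which `Φ_l` descends. -/
noncomputable def PhiRed {n : ℕ} (l : ℕ) {x y : ℝ} {σ : Matrix (Fin n) (Fin n) ℂ}
    {vhat : Fin n → ℂ} (p : MRed x y σ vhat) : ℂ :=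
  Quotient.lift (s := gaugeSetoid x y σ vhat) (fun g : M0 x y σ => Phi l (g : Phase n))
    (by
      rintro g g' ⟨f, hf, h, hh, e⟩
      rw [e, Phi_invariant l _ (leftGauge_le vhat hf) hh]) p

end Reduction

section Coordinates

/-- The variables `Λ_i = e^{2 λ_i}`. -/
noncomputable def Lam {n : ℕ} (lam : Fin n → ℝ) (i : Fin n) : ℝ := Real.exp (2 * lam i)

/-- `β_i = [Λ_i + Λ_i⁻¹ - x² - x⁻²]^{1/2}`. -/
noncomputable def betaOf {n : ℕ} (x : ℝ) (lam : Fin n → ℝ) (i : Fin n) : ℝ :=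
  Real.sqrt (Lam lam i + (Lam lam i)⁻¹ - x ^ 2 - (x ^ 2)⁻¹)

/-- `Γ_i = [(Λ_i - x⁻²) / (Λ_i - Λ_i⁻¹)]^{1/2}`. -/
noncomputable def gammaOf {n : ℕ} (x : ℝ) (lam : Fin n → ℝ) (i : Fin n) : ℝ :=
  Real.sqrt ((Lam lam i - (x ^ 2)⁻¹) / (Lam lam i - (Lam lam i)⁻¹))

/-- `Σ_i = [(x⁻² - Λ_i⁻¹) / (Λ_i - Λ_i⁻¹)]^{1/2}`. -/
noncomputable def sigmaOf {n : ℕ} (x : ℝ) (lam : Fin n → ℝ) (i : Fin n) : ℝ :=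
  Real.sqrt (((x ^ 2)⁻¹ - (Lam lam i)⁻¹) / (Lam lam i - (Lam lam i)⁻¹))

/-- The matrix `ρ` with blocks `diag Γ`, `diag Σ`, `diag Σ`, `-diag Γ`. It diagonalises
`Ω = b b†` for `b` with the blocks `x 1ₙ`, `diag β`, `0`, `x⁻¹ 1ₙ`: the eigenvalues are
`Λ_1, …, Λ_n, Λ_1⁻¹, …, Λ_n⁻¹`. -/
noncomputable def rho {n : ℕ} (x : ℝ) (lam : Fin n → ℝ) : Matrix (Idx n) (Idx n) ℂ :=
  fromBlocks (diagonal fun i => (gammaOf x lam i : ℂ)) (diagonal fun i => (sigmaOf x lam i : ℂ))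
    (diagonal fun i => (sigmaOf x lam i : ℂ)) (-diagonal fun i => (gammaOf x lam i : ℂ))

/-- The vector `w̃ = ρ w`. -/
noncomputable def wTilde {n : ℕ} (x : ℝ) (vhat : Fin n → ℂ) (lam : Fin n → ℝ) (g : Phase n) :
    Idx n → ℂ :=
  rho x lam *ᵥ wMap vhat g

/-- `g` lies in the gauge slice, where `b_R` has the diagonal real upper right block `diag β` with
`β_1 > … > β_n > 0` (expressed through `Λ_1 > … > Λ_n > max(x², x⁻²)`), none of the components of
`w̃` vanishes, and `λ`, `θ` are the coordinates of `g`: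
`β_i = [Λ_i + Λ_i⁻¹ - x² - x⁻²]^{1/2}` with `Λ_i = e^{2 λ_i}`, and
`w̃_j^* w̃_{n+j} = |w̃_j w̃_{n+j}| e^{i θ_j}`. -/
structure SliceCoords {n : ℕ} (x : ℝ) (vhat : Fin n → ℂ) (g : Phase n) (lam θ : Fin n → ℝ) :
    Prop where
  strictAnti : StrictAnti lam
  max_lt : ∀ i, max (x ^ 2) (x ^ 2)⁻¹ < Lam lam i
  bR_eq : mat (bR g) = fromBlocks ((x : ℂ) • 1) (diagonal fun i => (betaOf x lam i : ℂ)) 0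
    ((x : ℂ)⁻¹ • 1)
  wTilde_ne : ∀ a, wTilde x vhat lam g a ≠ 0
  angle : ∀ j, star (wTilde x vhat lam g (Sum.inl j)) * wTilde x vhat lam g (Sum.inr j) =
    (‖wTilde x vhat lam g (Sum.inl j) * wTilde x vhat lam g (Sum.inr j)‖ : ℂ) *
      Complex.exp (Complex.I * (θ j : ℂ))

/-- The point `p` of the reduced phase space has the coordinates `(λ, e^{iθ})`: this holds for some
point `g` of the orbit `p` in the gauge slice. -/
def HasCoords {n : ℕ} {x y : ℝ} {σ : Matrix (Fin n) (Fin n) ℂ} {vhat : Fin n → ℂ}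
    (p : MRed x y σ vhat) (lam θ : Fin n → ℝ) : Prop :=
  ∃ g : M0 x y σ, orbit vhat g = p ∧ SliceCoords x vhat (g : Phase n) lam θ

/-- The open polyhedron `λ_1 > … > λ_n > max(|v|, |u|)`, `λ_i - λ_{i+1} > μ`. -/
def polyhedron (n : ℕ) (u v μ : ℝ) : Set (Fin n → ℝ) :=
  {lam | StrictAnti lam ∧ (∀ i, max |v| |u| < lam i) ∧
    ∀ i j : Fin n, (i : ℕ) + 1 = j → μ < lam i - lam j}

/-- The constant `C`. -/
noncomputable def constC (n : ℕ) (u v μ : ℝ) : ℝ :=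
  n * Real.exp (u - v) + Real.cosh (v - u) / Real.sinh μ ^ 2

/-- The potential `V(λ)`. -/
noncomputable def potV {n : ℕ} (u v μ : ℝ) (lam : Fin n → ℝ) : ℝ :=
  Real.exp (v - u) *
    (Real.sinh v * Real.sinh u / Real.sinh μ ^ 2 *
        ∏ k, (1 - Real.sinh μ ^ 2 / Real.sinh (lam k) ^ 2)
      - Real.cosh v * Real.cosh u / Real.sinh μ ^ 2 *
        ∏ k, (1 + Real.sinh μ ^ 2 / Real.cosh (lam k) ^ 2)
      + constC n u v μ)

/-- The Ruijsenaars--Schneider--van Diejen type Hamiltonian. -/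
noncomputable def hamRSvD {n : ℕ} (u v μ : ℝ) (lam θ : Fin n → ℝ) : ℝ :=
  potV u v μ lam + Real.exp (v - u) * ∑ k, Real.cos (θ k) / Real.cosh (lam k) ^ 2 *
    Real.sqrt (1 - Real.sinh v ^ 2 / Real.sinh (lam k) ^ 2) *
    Real.sqrt (1 - Real.sinh u ^ 2 / Real.sinh (lam k) ^ 2) *
    ∏ l ∈ Finset.univ.erase k,
      (Real.sqrt (1 - Real.sinh μ ^ 2 / Real.sinh (lam k - lam l) ^ 2) *
        Real.sqrt (1 - Real.sinh μ ^ 2 / Real.sinh (lam k + lam l) ^ 2))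

end Coordinates

end SU2n

namespace SU2n

open Matrix

/-! ### Determinant and quadratic identities for the Gram matrix `b b†` -/

section LinearAlgebra

/-! Write `g = k b_R = b_L k'`. Then `M = g g† = b_L b_L†` and `Ω = b_R b_R†` are conjugate by `k =
k_L`. The slice form of `b_R` makes `ρ` diagonalise `Ω`, so `U = ρ k†` diagonalises `M` with
eigenvalues `L = (Λ_i, Λ_i⁻¹)`, and `w̃ = U ŵ` lists the coordinates of `ŵ` in that eigenbasis.
Below, `t = α²` and `Y = y²`.

The block form of `b_L`, with `σσ† = t + v̂v̂†`, gives a determinant identity relating a rank-one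
perturbation of `zM - t` to `z - M` (`det_gramLeft`). Expressed through eigenvalues it is a
polynomial identity in `z` that determines all `|w̃_a|²` (`sum_normSq_resolvent`). At `z = t / L_b`
it yields `|w̃_b|²` as a product (`weight_eq`); at `z = ±t` it yields the sums of `|w̃_b|² / (L_b ∓
1)` (`sum_weight_div`).

For the Hamiltonian, let `P` project onto the second block and put `Q = k† P k`. Both satisfy
quadratic relations with `Ω`; comparing the two expressions for `tr(ΩQΩP)` gives `(1 - t)(n - Φ₁) =
2 ∑ |w_{n+j}|²` (`slice_relations`). Since `w = ρ w̃`, each `|w_{n+j}|²` consists of `Σ_j²|w̃_j|² +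
Γ_j²|w̃_{n+j}|²` and a cross term in `cos θ_j`. The first part sums to `V` through the values at `z
= ±t` (`potV_eq`); the cross terms are evaluated by the product formula (`cos_coeff_eq`).

The inequalities on `λ` come from positivity: every `|w̃_a|²` is nonzero, hence every product in
`weight_eq` is positive, and a sign analysis of these `2n` products leaves only the polyhedron
(`gaps_of_weight_pos`). -/

theorem det_fromBlocks_smul_one {m : Type*} [Fintype m] [DecidableEq m] (A B C : Matrix m m ℂ)
    (d : ℂ) : (fromBlocks A B C (d • (1 : Matrix m m ℂ))).det = (d • A - B * C).det := by
  have hne : ∀ d : ℂ, d ≠ 0 →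
      (fromBlocks A B C (d • (1 : Matrix m m ℂ))).det = (d • A - B * C).det := by
    intro d hd
    have h1 : fromBlocks A B C (d • (1 : Matrix m m ℂ)) * fromBlocks (d • 1) 0 (-C) 1 =
        fromBlocks (d • A - B * C) B 0 (d • 1) := by
      rw [fromBlocks_multiply]
      congr 1 <;> simp [sub_eq_add_neg]
    have h2 := congrArg Matrix.det h1
    rw [Matrix.det_mul, det_fromBlocks_zero₁₂, det_fromBlocks_zero₂₁, det_one, mul_one] at h2
    refine mul_right_cancel₀ ?_ h2
    rw [det_smul, det_one, mul_one]
    exact pow_ne_zero _ hd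
  -- Both sides are polynomial in `d`, so continuity covers `d = 0`. This case matters: the identity
  -- is applied with `d = z - y²`, which may vanish.
  have hc1 : Continuous fun d : ℂ => (fromBlocks A B C (d • (1 : Matrix m m ℂ))).det := by
    refine Continuous.matrix_det (continuous_matrix ?_)
    rintro (i | i) (j | j) <;> simp <;> fun_prop
  have hc2 : Continuous fun d : ℂ => (d • A - B * C).det := by
    refine Continuous.matrix_det (continuous_matrix fun i j => ?_)
    simp; fun_prop
  exact congrFun (Continuous.ext_on (dense_compl_singleton (0 : ℂ)) hc1 hc2
    fun d hd => hne d hd) d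

theorem det_diagonal_sub_vecMulVec {ι : Type*} [Fintype ι] [DecidableEq ι] (d a b : ι → ℂ) (c : ℂ)
    (hd : ∀ i, d i ≠ 0) :
    (diagonal d - c • vecMulVec a b).det = (∏ i, d i) * (1 - c * ∑ i, a i * b i / d i) := by
  have h1 : diagonal d - c • vecMulVec a b =
      diagonal d * (1 + replicateCol Unit (fun i => a i / d i) * replicateRow Unit (-c • b)) := by
    ext i j
    rw [diagonal_mul, ← vecMulVec_eq]
    simp only [Matrix.sub_apply, Matrix.smul_apply, Matrix.add_apply, vecMulVec_apply, diagonal_apply, one_apply,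
      Pi.smul_apply, smul_eq_mul]
    have := hd i
    split_ifs <;> field_simp <;> ring
  rw [h1, det_mul, det_diagonal, det_one_add_replicateCol_mul_replicateRow, dotProduct,
    Finset.mul_sum, sub_eq_add_neg, ← Finset.sum_neg_distrib]
  congr 2
  refine Finset.sum_congr rfl fun i _ => ?_
  simp only [Pi.smul_apply, smul_eq_mul]
  ring

/-- In an eigenbasis of `M` only the eigenvalues and the coordinates of `a` survive. The choice `r =
0` gives the characteristic polynomial. -/
theorem det_sub_of_conj {ι : Type*} [Fintype ι] [DecidableEq ι] {U M : Matrix ι ι ℂ} {L : ι → ℂ}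
    (hU : Uᴴ * U = 1) (hM : U * M * Uᴴ = diagonal L) (a : ι → ℂ) (p q r : ℂ) :
    (p • M - q • (1 : Matrix ι ι ℂ) - r • vecMulVec a (star a)).det =
      (diagonal (fun i => p * L i - q) - r • vecMulVec (U *ᵥ a) (star (U *ᵥ a))).det := by
  have hU' : U * Uᴴ = 1 := mul_eq_one_comm.1 hU
  have h : diagonal (fun i => p * L i - q) - r • vecMulVec (U *ᵥ a) (star (U *ᵥ a)) =
      U * (p • M - q • (1 : Matrix ι ι ℂ) - r • vecMulVec a (star a)) * Uᴴ := by
    have h1 : (diagonal fun i => p * L i - q) = p • diagonal L - q • (1 : Matrix ι ι ℂ) := by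
      ext i j
      simp only [diagonal_apply, Matrix.sub_apply, Matrix.smul_apply, one_apply, smul_eq_mul]
      split_ifs <;> ring
    rw [h1, Matrix.mul_sub, Matrix.mul_sub, Matrix.sub_mul, Matrix.sub_mul, star_mulVec]
    simp only [Matrix.mul_smul, Matrix.smul_mul, hM, Matrix.mul_one, hU', mul_vecMulVec,
      vecMulVec_mul]
  rw [h, det_mul, det_mul, mul_right_comm, ← det_mul, hU', det_one, one_mul]

variable {n : ℕ}

/-- The matrix `b b†` for `b = [[y⁻¹ σ, X], [0, y]]`, with `S = σ σ†`. -/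
noncomputable def gramLeft (y : ℂ) (S X : Matrix (Fin n) (Fin n) ℂ) : Matrix (Idx n) (Idx n) ℂ :=
  fromBlocks ((y ^ 2)⁻¹ • S + X * Xᴴ) (y • X) (y • Xᴴ) (y ^ 2 • 1)

/-- After Schur complementation with respect to the scalar lower right block, both determinants are
those of `n × n` matrices in `1`, `XX†` and `v̂v̂†`. They are proportional with ratio `t`; `c` is
the value that makes the coefficients of `v̂v̂†` agree. -/
theorem det_gramLeft (y t z c : ℂ) (hy : y ≠ 0) (hc : c * (z * y ^ 2 - t) = z ^ 2 - t)
    (vhat : Fin n → ℂ) (S X : Matrix (Fin n) (Fin n) ℂ)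
    (hS : S = t • (1 : Matrix (Fin n) (Fin n) ℂ) + vecMulVec vhat (star vhat)) :
    (z • gramLeft y S X - t • 1 - c • vecMulVec (wHat vhat) (star (wHat vhat))).det =
      t ^ n * ((-1 : ℂ) • gramLeft y S X - (-z) • (1 : Matrix (Idx n) (Idx n) ℂ)).det := by
  have e1 : z • gramLeft y S X - t • 1 - c • vecMulVec (wHat vhat) (star (wHat vhat)) =
      fromBlocks (z • ((y ^ 2)⁻¹ • S + X * Xᴴ) - t • 1 - c • vecMulVec vhat (star vhat))
        ((z * y) • X) ((z * y) • Xᴴ) ((z * y ^ 2 - t) • 1) := by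
    ext (i | i) (j | j) <;>
      simp [gramLeft, wHat, vecMulVec_apply, one_apply] <;> (try split_ifs) <;> ring
  have e2 : (-1 : ℂ) • gramLeft y S X - (-z) • (1 : Matrix (Idx n) (Idx n) ℂ) =
      fromBlocks (z • 1 - ((y ^ 2)⁻¹ • S + X * Xᴴ))
        ((-y) • X) ((-y) • Xᴴ) ((z - y ^ 2) • 1) := by
    ext (i | i) (j | j) <;>
      simp [gramLeft, one_apply] <;> (try split_ifs) <;> ring
  rw [e1, e2, det_fromBlocks_smul_one, det_fromBlocks_smul_one]
  have e3 : (z * y ^ 2 - t) • (z • ((y ^ 2)⁻¹ • S + X * Xᴴ) - t • 1 -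
      c • vecMulVec vhat (star vhat)) - (z * y) • X * (z * y) • Xᴴ =
      t • ((z - y ^ 2) • (z • 1 - ((y ^ 2)⁻¹ • S + X * Xᴴ)) - (-y) • X * (-y) • Xᴴ) := by
    rw [hS]
    simp only [Matrix.smul_mul, Matrix.mul_smul]
    generalize X * Xᴴ = H
    ext i j
    simp only [Matrix.sub_apply, Matrix.add_apply, Matrix.smul_apply, smul_eq_mul]
    generalize vecMulVec vhat (star vhat) i j = V
    generalize (1 : Matrix (Fin n) (Fin n) ℂ) i j = E
    field_simp
    linear_combination (-y ^ 2 * V) * hc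
  rw [e3, det_smul, Fintype.card_fin]

/-- The generating function of the `|w̃_a|²`. -/
theorem sum_normSq_resolvent (y t : ℂ) (hy : y ≠ 0)
    (vhat : Fin n → ℂ) (S X : Matrix (Fin n) (Fin n) ℂ)
    (hS : S = t • (1 : Matrix (Fin n) (Fin n) ℂ) + vecMulVec vhat (star vhat))
    {U : Matrix (Idx n) (Idx n) ℂ} {L : Idx n → ℂ} (hL : ∀ a, L a ≠ 0)
    (hU : Uᴴ * U = 1) (hM : U * gramLeft y S X * Uᴴ = diagonal L) (z : ℂ) :
    (z ^ 2 - t) * ∑ b, (U *ᵥ wHat vhat) b * star ((U *ᵥ wHat vhat) b) *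
        ∏ c ∈ Finset.univ.erase b, (z * L c - t) =
      (z * y ^ 2 - t) * (∏ c, (z * L c - t) - t ^ n * ∏ c, (z - L c)) := by
  set w := U *ᵥ wHat vhat with hw
  -- The divisions are legitimate away from finitely many `z`; both sides are continuous and the
  -- complement is dense.
  have hgen : ∀ z : ℂ, z ∈ ({t / y ^ 2} ∪ Set.range fun a => t / L a : Set ℂ)ᶜ →
      (z ^ 2 - t) * ∑ b, w b * star (w b) * ∏ c ∈ Finset.univ.erase b, (z * L c - t) =
      (z * y ^ 2 - t) * (∏ c, (z * L c - t) - t ^ n * ∏ c, (z - L c)) := by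
    intro z hz
    simp only [Set.mem_compl_iff, Set.mem_union, Set.mem_singleton_iff, Set.mem_range,
      not_or, not_exists] at hz
    have h1 : z * y ^ 2 - t ≠ 0 := fun h => hz.1 (by field_simp; linear_combination h)
    have h2 : ∀ a, z * L a - t ≠ 0 := fun a h => hz.2 a (by
      have := hL a
      field_simp; linear_combination -h)
    have h3 := det_gramLeft y t z ((z ^ 2 - t) / (z * y ^ 2 - t)) hy
      (div_mul_cancel₀ _ h1) vhat S X hS
    have h4 := det_sub_of_conj hU hM (wHat vhat) (-1) (-z) 0
    rw [zero_smul, zero_smul, sub_zero, sub_zero, det_diagonal] at h4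
    rw [det_sub_of_conj hU hM, det_diagonal_sub_vecMulVec _ _ _ _ h2, h4] at h3
    have h5 : ∀ b, w b * star (w b) * ∏ c ∈ Finset.univ.erase b, (z * L c - t) =
        (∏ c, (z * L c - t)) * (w b * star w b / (z * L b - t)) := by
      intro b
      rw [← Finset.mul_prod_erase _ _ (Finset.mem_univ b), Pi.star_apply]
      have := h2 b
      field_simp
    have h6 : ∏ i, (-1 * L i - -z) = ∏ c, (z - L c) :=
      Finset.prod_congr rfl fun i _ => by ring
    simp_rw [h5]
    rw [← Finset.mul_sum, ← h6, ← h3, ← hw]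
    field_simp
    ring
  have hc : Set.Countable ({t / y ^ 2} ∪ Set.range fun a => t / L a : Set ℂ) :=
    ((Set.finite_singleton _).union (Set.finite_range _)).countable
  exact congrFun (Continuous.ext_on (hc.dense_compl ℂ) (by fun_prop) (by fun_prop)
    fun z hz => hgen z hz) z

theorem trace_mul_vecMulVec {ι : Type*} [Fintype ι] (A : Matrix ι ι ℂ) (a b : ι → ℂ) :
    (vecMulVec a b * A).trace = b ⬝ᵥ A *ᵥ a := by
  rw [Matrix.trace_mul_comm, mul_vecMulVec, trace_vecMulVec, dotProduct_comm]

/-- The projection onto the second block. -/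
def projTwo (n : ℕ) : Matrix (Idx n) (Idx n) ℂ := fromBlocks 0 0 0 1

/-- The left side is the second block column of the Gram matrix times its adjoint. It differs from
`y²` times the Gram matrix only by `S` in the upper left block. -/
theorem gramLeft_mul_projTwo (y t : ℂ) (hy : y ≠ 0)
    (vhat : Fin n → ℂ) (S X : Matrix (Fin n) (Fin n) ℂ)
    (hS : S = t • (1 : Matrix (Fin n) (Fin n) ℂ) + vecMulVec vhat (star vhat)) :
    gramLeft y S X * projTwo n * gramLeft y S X =
      y ^ 2 • gramLeft y S X - t • (1 - projTwo n) - vecMulVec (wHat vhat) (star (wHat vhat)) := by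
  rw [gramLeft, projTwo, fromBlocks_multiply, fromBlocks_multiply, hS]
  simp only [Matrix.mul_zero, Matrix.mul_one, zero_add, add_zero, Matrix.smul_mul,
    Matrix.mul_smul, Matrix.one_mul]
  generalize X * Xᴴ = H
  ext (i | i) (j | j) <;>
    simp [wHat, vecMulVec_apply, one_apply] <;> (try split_ifs) <;> field_simp <;> ring

end LinearAlgebra

/-! ### The weights `|w̃_a|²`: product formula, sums, positivity -/

section Weights

variable {n : ℕ}

/-- If `W` has the generating function of `sum_normSq_resolvent`, then its values are the residues
at the nodes. -/
theorem weight_eq {ι : Type*} [Fintype ι] [DecidableEq ι] (hcard : Fintype.card ι = 2 * n)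
    {L W : ι → ℝ} {t Y : ℝ} (ht : t ≠ 0) (hL : ∀ a, L a ≠ 0) (hinj : Function.Injective L)
    (hgen : ∀ z : ℝ, (z ^ 2 - t) * ∑ b, W b * ∏ c ∈ Finset.univ.erase b, (z * L c - t) =
      (z * Y - t) * (∏ c, (z * L c - t) - t ^ n * ∏ c, (z - L c)))
    (hdeg : ∀ a, L a ^ 2 = t → W a = Y * L a - t) (b : ι) :
    t ^ n * W b =
      t * (L b - Y) * ∏ c ∈ Finset.univ.erase b, (L b * L c - t) / (L b - L c) := by
  have hb := hL b
  obtain ⟨N, hN⟩ : ∃ N, (Finset.univ.erase b).card = N := ⟨_, rfl⟩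
  have hN2 : 2 * n = N + 1 := by
    rw [← hN, ← hcard, Finset.card_erase_add_one (Finset.mem_univ b), Finset.card_univ]
  have hne : ∀ c ∈ Finset.univ.erase b, L b - L c ≠ 0 := fun c hc =>
    sub_ne_zero.2 fun h => Finset.ne_of_mem_erase hc (hinj h).symm
  -- If `L_b² = t`, the node `t / L_b` is a zero of `z² - t` and the generating identity degenerates
  -- there, so `hdeg` supplies the value. Each of the `2n - 1` factors then equals `-L_b`, and the
  -- same product formula holds.
  by_cases hd : L b ^ 2 = t
  · have hpr : ∏ c ∈ Finset.univ.erase b, (L b * L c - t) / (L b - L c) = -L b ^ N := by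
      have hodd : Odd N := by
        rcases Nat.even_or_odd N with h | h
        · obtain ⟨k, hk⟩ := h
          omega
        · exact h
      rw [Finset.prod_congr rfl (g := fun _ => -L b), Finset.prod_const, hN, hodd.neg_pow]
      intro c hc
      have := hne c hc
      rw [← hd]
      field_simp
      ring
    have htn : t ^ n = L b ^ (N + 1) := by rw [← hd, ← pow_mul, hN2]
    rw [hpr, htn, hdeg b hd, ← hd]
    ring
  -- At this node every summand except the one of index `b` vanishes, and so does the first product
  -- on the right.
  · have h := hgen (t / L b)
    rw [Finset.sum_eq_single b _ (by simp)] at h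
    · rw [Finset.prod_eq_zero (Finset.mem_univ b) (by field_simp; ring), zero_sub,
        ← Finset.mul_prod_erase _ _ (Finset.mem_univ b)] at h
      have e1 : ∏ c ∈ Finset.univ.erase b, (t / L b * L c - t) =
          (t / L b) ^ N * ∏ c ∈ Finset.univ.erase b, (L c - L b) := by
        rw [← hN, ← Finset.prod_const, ← Finset.prod_mul_distrib]
        refine Finset.prod_congr rfl fun c _ => ?_
        field_simp
      have e2 : ∏ c ∈ Finset.univ.erase b, (t / L b - L c) =
          (1 / L b) ^ N * ∏ c ∈ Finset.univ.erase b, (t - L b * L c) := by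
        rw [← hN, ← Finset.prod_const, ← Finset.prod_mul_distrib]
        refine Finset.prod_congr rfl fun c _ => ?_
        field_simp
      have e3 : ∏ c ∈ Finset.univ.erase b, (L b * L c - t) / (L b - L c) =
          (∏ c ∈ Finset.univ.erase b, (t - L b * L c)) /
            ∏ c ∈ Finset.univ.erase b, (L c - L b) := by
        rw [← Finset.prod_div_distrib]
        refine Finset.prod_congr rfl fun c _ => ?_
        rw [← neg_sub, ← neg_sub (L c), neg_div_neg_eq]
      have hP : ∏ c ∈ Finset.univ.erase b, (L c - L b) ≠ 0 :=
        Finset.prod_ne_zero_iff.2 fun c hc h => hne c hc (by linarith)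
      rw [e3]
      rw [e1, e2] at h
      simp only [div_pow, one_pow] at h
      generalize ∏ c ∈ Finset.univ.erase b, (L c - L b) = P at *
      generalize ∏ c ∈ Finset.univ.erase b, (t - L b * L c) = R at *
      have hd' : t - L b ^ 2 ≠ 0 := fun h' => hd (by linarith)
      have htn : t ^ n * t ^ n = t ^ N * t := by rw [← pow_add, ← two_mul, hN2, pow_succ]
      have hbN : L b ^ N ≠ 0 := pow_ne_zero _ hb
      have htn0 : t ^ n ≠ 0 := pow_ne_zero _ ht
      have h2 : t ^ N * W b * P = (L b - Y) * t ^ n * R := by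
        generalize L b ^ N = q at *
        generalize t ^ N = r at *
        generalize t ^ n = s at *
        field_simp at h
        linear_combination h
      rw [mul_div_assoc', eq_div_iff hP]
      refine mul_left_cancel₀ htn0 ?_
      linear_combination W b * P * htn + t * h2
    · intro c _ hc
      rw [Finset.prod_eq_zero (Finset.mem_erase.2 ⟨hc.symm, Finset.mem_univ b⟩), mul_zero]
      field_simp
      ring

/-- Evaluation at `z = εt`: since `ε² = 1`, `zL - t = εt(L - ε)` and `z² - t = t(t - 1)`, so the
erased products become the simple fractions `1 / (L_b - ε)`. -/
theorem sum_weight_div {ι : Type*} [Fintype ι] [DecidableEq ι]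
    (hcard : Fintype.card ι = 2 * n) {L W : ι → ℝ} {t Y ε : ℝ} (ht : t ≠ 0)
    (hε : ε ^ 2 = 1) (hL : ∀ a, ε - L a ≠ 0)
    (hgen : ∀ z : ℝ, (z ^ 2 - t) * ∑ b, W b * ∏ c ∈ Finset.univ.erase b, (z * L c - t) =
      (z * Y - t) * (∏ c, (z * L c - t) - t ^ n * ∏ c, (z - L c))) :
    (t - 1) * ∑ b, W b / (L b - ε) =
      t * (Y - ε) * (1 - (∏ c, (ε * t - L c) / (ε - L c)) / t ^ n) := by
  have hε0 : ε ≠ 0 := by rintro rfl; norm_num at hε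
  have hL' : ∀ a, L a - ε ≠ 0 := fun a h => hL a (by linarith)
  have h := hgen (ε * t)
  have hpow : (ε * t) ^ (2 * n) = t ^ n * t ^ n := by
    rw [mul_pow, pow_mul, hε, one_pow, one_mul, two_mul, pow_add]
  have e1 : ∏ c, (ε * t * L c - t) = t ^ n * t ^ n * ∏ c, (ε - L c) := by
    rw [← hpow, ← hcard, ← Finset.card_univ, ← Finset.prod_const, ← Finset.prod_mul_distrib]
    -- The number of factors is even, so reversing the sign of each one changes nothing.
    have hneg : ∏ c, (ε * t * (ε - L c)) = ∏ c, (-(ε * t * (ε - L c))) := by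
      rw [Finset.prod_neg, Finset.card_univ, hcard, pow_mul]
      simp
    rw [hneg]
    refine Finset.prod_congr rfl fun c _ => ?_
    linear_combination t * hε
  have e2 : ∀ b, W b * ∏ c ∈ Finset.univ.erase b, (ε * t * L c - t) =
      (∏ c, (ε * t * L c - t)) / (ε * t) * (W b / (L b - ε)) := by
    intro b
    have h1 : ε * t * L b - t = ε * t * (L b - ε) := by linear_combination t * hε
    rw [← Finset.mul_prod_erase _ _ (Finset.mem_univ b), h1]
    have := hL' b
    field_simp
  simp_rw [e2] at h
  rw [← Finset.mul_sum, e1] at h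
  rw [Finset.prod_div_distrib]
  have hP : ∏ c, (ε - L c) ≠ 0 := Finset.prod_ne_zero_iff.2 fun c _ => hL c
  have htn : t ^ n ≠ 0 := pow_ne_zero _ ht
  generalize ∏ c, (ε - L c) = P at *
  generalize ∏ c, (ε * t - L c) = R at *
  generalize ∑ b, W b / (L b - ε) = T at *
  generalize t ^ n = s at *
  have h2 : t * (t - 1) * (s * P * T) = t * ε * (ε * Y - 1) * t * (s * P - R) := by
    field_simp at h
    linear_combination t * h - s * P * T * t ^ 2 * hε
  field_simp
  refine mul_left_cancel₀ ht ?_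
  linear_combination h2 + t ^ 2 * Y * (s * P - R) * hε

theorem prod_erase_inl (j : Fin n) (f : Idx n → ℝ) :
    ∏ c ∈ Finset.univ.erase (Sum.inl j), f c =
      f (Sum.inr j) * ∏ l ∈ Finset.univ.erase j, (f (Sum.inl l) * f (Sum.inr l)) := by
  have h : (Finset.univ.erase (Sum.inl j) : Finset (Idx n)) =
      (Finset.univ.erase j).disjSum Finset.univ := by
    ext (i | i) <;> simp
  rw [h, Finset.prod_disjSum, Finset.prod_mul_distrib,
    ← Finset.mul_prod_erase Finset.univ _ (Finset.mem_univ j)]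
  ring

theorem prod_erase_inr (j : Fin n) (f : Idx n → ℝ) :
    ∏ c ∈ Finset.univ.erase (Sum.inr j), f c =
      f (Sum.inl j) * ∏ l ∈ Finset.univ.erase j, (f (Sum.inl l) * f (Sum.inr l)) := by
  have h : (Finset.univ.erase (Sum.inr j) : Finset (Idx n)) =
      Finset.univ.disjSum (Finset.univ.erase j) := by
    ext (i | i) <;> simp
  rw [h, Finset.prod_disjSum, Finset.prod_mul_distrib,
    ← Finset.mul_prod_erase Finset.univ _ (Finset.mem_univ j)]
  ring

/-- The numbers `a_1, …, a_n, a_1⁻¹, …, a_n⁻¹`. -/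
noncomputable def recipExt (a : Fin n → ℝ) : Idx n → ℝ := Sum.elim a fun j => (a j)⁻¹

theorem recipExt_injective {a : Fin n → ℝ} (ha : StrictAnti a) (h1 : ∀ j, 1 < a j) :
    Function.Injective (recipExt a) := by
  have h2 : ∀ j, (a j)⁻¹ < 1 := fun j => inv_lt_one_of_one_lt₀ (h1 j)
  rintro (i | i) (j | j) h <;> simp only [recipExt, Sum.elim_inl, Sum.elim_inr] at h
  · rw [ha.injective h]
  · linarith [h1 i, h2 j]
  · linarith [h1 j, h2 i]
  · rw [ha.injective (inv_injective h)]

theorem recipExt_pos {a : Fin n → ℝ} (h1 : ∀ j, 1 < a j) (b : Idx n) : 0 < recipExt a b := by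
  rcases b with j | j
  · exact one_pos.trans (h1 j)
  · exact inv_pos.2 (one_pos.trans (h1 j))

/-- Used to discard factors of known positive sign, so that only the undecided ones remain in the
product. -/
theorem pos_mul_prod_of {ι : Type*} {s : Finset ι} {x : ℝ} {f g : ι → ℝ}
    (h : ∀ l ∈ s, ∃ p > 0, f l = p * g l) (hf : 0 < x * ∏ l ∈ s, f l) :
    0 < x * ∏ l ∈ s, g l := by
  choose! p hp hfg using h
  rw [Finset.prod_congr rfl hfg, Finset.prod_mul_distrib, mul_left_comm] at hf
  exact (mul_pos_iff_of_pos_left (Finset.prod_pos hp)).1 hf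

/-! ### From positive weights to the gap inequalities -/

section Signs

variable {a : Fin n → ℝ} {t Y : ℝ}

/-- The factors of `l` and of its reciprocal combine to `(a_j a_l - t)(a_j - t a_l) / ((a_j -
a_l)(a_j a_l - 1))`. This is positive for `l > j` and has the sign of `t a_l - a_j` for `l < j`. -/
theorem pos_of_weight_inl (ha : StrictAnti a) (h1 : ∀ j, 1 < a j) (ht : 0 < t) (ht1 : t < 1)
    (hpos : ∀ b : Idx n, 0 < (recipExt a b - Y) * ∏ c ∈ Finset.univ.erase b,
      (recipExt a b * recipExt a c - t) / (recipExt a b - recipExt a c)) (j : Fin n) :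
    0 < (a j - Y) * ∏ l ∈ Finset.univ.erase j, (if l < j then t * a l - a j else 1) := by
  have h := hpos (Sum.inl j)
  rw [prod_erase_inl] at h
  simp only [recipExt, Sum.elim_inl, Sum.elim_inr] at h
  have hj := h1 j
  have hlead : 0 < (a j * (a j)⁻¹ - t) / (a j - (a j)⁻¹) := by
    have := inv_lt_one_of_one_lt₀ hj
    rw [mul_inv_cancel₀ (by linarith)]
    exact div_pos (by linarith) (by linarith)
  rw [mul_left_comm] at h
  refine pos_mul_prod_of (fun l hl => ?_) ((mul_pos_iff_of_pos_left hlead).1 h)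
  have hl1 := h1 l
  have hlj : 1 < a j * a l := by nlinarith
  have e : (a j * a l - t) / (a j - a l) * ((a j * (a l)⁻¹ - t) / (a j - (a l)⁻¹)) =
      (a j * a l - t) * (a j - t * a l) / ((a j - a l) * (a j * a l - 1)) := by
    have h3 : a l ≠ 0 := by linarith
    have h5 : a j - (a l)⁻¹ = (a j * a l - 1) / a l := by field_simp
    have h6 : a j * (a l)⁻¹ - t = (a j - t * a l) / a l := by field_simp
    rw [h5, h6, div_div_div_cancel_right₀ h3, div_mul_div_comm]
  rw [e]
  rcases lt_or_gt_of_ne (Finset.ne_of_mem_erase hl) with hlt | hgt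
  · have := ha hlt
    refine ⟨(a j * a l - t) / ((a l - a j) * (a j * a l - 1)),
      div_pos (by linarith) (mul_pos (by linarith) (by linarith)), ?_⟩
    rw [if_pos hlt]
    have h2 : a j - a l ≠ 0 := by linarith
    have h3 : a l - a j ≠ 0 := by linarith
    have h4 : a j * a l - 1 ≠ 0 := by linarith
    field_simp
    ring
  · have := ha hgt
    refine ⟨_, ?_, by rw [if_neg (not_lt.2 hgt.le), mul_one]⟩
    exact div_pos (mul_pos (by linarith) (by nlinarith)) (mul_pos (by linarith) (by linarith))

/-- Only the factors `1 / (a_j a_l - 1)` and the leading one are dropped: the sign of the rest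
depends on where `j` stands, and it is settled later for the last two indices. -/
theorem pos_of_weight_inr (h1 : ∀ j, 1 < a j) (ht1 : t < 1)
    (hpos : ∀ b : Idx n, 0 < (recipExt a b - Y) * ∏ c ∈ Finset.univ.erase b,
      (recipExt a b * recipExt a c - t) / (recipExt a b - recipExt a c)) (j : Fin n) :
    0 < (Y - (a j)⁻¹) * ∏ l ∈ Finset.univ.erase j,
      ((a l - t * a j) * (1 - t * a j * a l) / (a j - a l)) := by
  have h := hpos (Sum.inr j)
  rw [prod_erase_inr] at h
  simp only [recipExt, Sum.elim_inl, Sum.elim_inr] at h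
  have hj := h1 j
  have hlead : 0 < ((a j)⁻¹ * a j - t) / (a j - (a j)⁻¹) := by
    have := inv_lt_one_of_one_lt₀ hj
    rw [inv_mul_cancel₀ (by linarith)]
    exact div_pos (by linarith) (by linarith)
  have hflip : ((a j)⁻¹ - Y) * (((a j)⁻¹ * a j - t) / ((a j)⁻¹ - a j)) =
      ((a j)⁻¹ * a j - t) / (a j - (a j)⁻¹) * (Y - (a j)⁻¹) := by
    rw [← neg_sub (a j), div_neg]
    ring
  rw [← mul_assoc, hflip, mul_assoc] at h
  refine pos_mul_prod_of (fun l hl => ?_) ((mul_pos_iff_of_pos_left hlead).1 h)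
  have hl1 := h1 l
  have hlj : 1 < a j * a l := by nlinarith
  refine ⟨1 / (a j * a l - 1), div_pos one_pos (by linarith), ?_⟩
  have h2 : a j ≠ 0 := by linarith
  have h3 : a l ≠ 0 := by linarith
  have h4 : a j * a l - 1 ≠ 0 := by linarith
  have e1 : (a j)⁻¹ * a l - t = (a l - t * a j) / a j := by field_simp
  have e2 : (a j)⁻¹ - a l = -(a j * a l - 1) / a j := by field_simp; ring
  have e3 : (a j)⁻¹ * (a l)⁻¹ - t = (1 - t * a j * a l) / (a j * a l) := by field_simp
  have e4 : (a j)⁻¹ - (a l)⁻¹ = -(a j - a l) / (a j * a l) := by field_simp; ring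
  rw [e1, e2, e3, e4, div_div_div_cancel_right₀ h2, div_div_div_cancel_right₀ (mul_ne_zero h2 h3),
    div_neg, div_neg, neg_mul_neg, div_mul_div_comm, div_mul_div_comm, one_mul]

/-- Values at distance at least two satisfy the gap condition. -/
theorem gap_of_add_two_le (ha : StrictAnti a) (ht : 0 < t)
    (hA : ∀ j, 0 < (a j - Y) *
      ∏ l ∈ Finset.univ.erase j, (if l < j then t * a l - a j else 1))
    (l j : Fin n) (hlj : (l : ℕ) + 2 ≤ j) : a j < t * a l := by
  obtain ⟨m, hm⟩ : ∃ m : ℕ, m = (j : ℕ) := ⟨_, rfl⟩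
  induction m using Nat.strong_induction_on generalizing l j with
  | _ m ih =>
    have hj := j.2
    let k : Fin n := ⟨(j : ℕ) - 2, by omega⟩
    let i : Fin n := ⟨(j : ℕ) - 1, by omega⟩
    have hk : (k : ℕ) + 2 = j := by simp [k]; omega
    have hi : (i : ℕ) + 1 = j := by simp [i]; omega
    have hki : k < i := Fin.lt_def.2 (by omega)
    have hij : i < j := Fin.lt_def.2 (by omega)
    have haij := ha hij
    have haki := ha hki
    have hsmall : ∀ l : Fin n, l < k → a i < t * a l := fun l hl =>
      ih i (by omega) l i (by have := Fin.lt_def.1 hl; omega) rfl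
    -- Strong induction on `j`. By monotonicity the case `k = j - 2` is enough, and the induction
    -- hypothesis at `i = j - 1` makes all factors with `l < k` positive for both `i` and `j`.
    suffices hmain : a j < t * a k by
      have : a k ≤ a l := ha.antitone (Fin.le_def.2 (by omega))
      nlinarith
    by_contra hcon
    push Not at hcon
    have hu : t * a i - a j < 0 := by nlinarith
    have hj2 : 0 < (a j - Y) * ∏ l ∈ Finset.univ.erase j,
        ((if l = i then t * a i - a j else 1) * (if l = k then t * a k - a j else 1)) := by
      refine pos_mul_prod_of (fun l hl => ?_) (hA j)
      by_cases h1 : l = i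
      · subst h1
        exact ⟨1, one_pos, by rw [if_pos hij, if_pos rfl, if_neg hki.ne']; ring⟩
      by_cases h2 : l = k
      · subst h2
        exact ⟨1, one_pos, by rw [if_pos (hki.trans hij), if_pos rfl, if_neg h1]; ring⟩
      by_cases h3 : l < j
      · have hlk : l < k := by
          have e1 := Fin.lt_def.1 h3
          have e2 : (l : ℕ) ≠ i := fun h => h1 (Fin.ext h)
          have e3 : (l : ℕ) ≠ k := fun h => h2 (Fin.ext h)
          exact Fin.lt_def.2 (by omega)
        have := hsmall l hlk
        exact ⟨t * a l - a j, by linarith, by rw [if_pos h3, if_neg h1, if_neg h2]; ring⟩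
      · exact ⟨1, one_pos, by rw [if_neg h3, if_neg h1, if_neg h2]; ring⟩
    rw [Finset.prod_mul_distrib, Finset.prod_ite_eq', Finset.prod_ite_eq',
      if_pos (Finset.mem_erase.2 ⟨hij.ne, Finset.mem_univ _⟩),
      if_pos (Finset.mem_erase.2 ⟨(hki.trans hij).ne, Finset.mem_univ _⟩)] at hj2
    -- Only the factors of `i` and `k` are left, and under the contrary assumption neither is
    -- positive; their product is nonnegative, which forces `Y < a_j`. The condition at `i` then
    -- demands `t a_k > a_i > a_j`, a contradiction.
    have hY : Y < a j := by
      have : 0 ≤ (t * a i - a j) * (t * a k - a j) :=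
        mul_nonneg_of_nonpos_of_nonpos hu.le (by linarith)
      by_contra hc
      push Not at hc
      nlinarith [mul_nonneg (sub_nonneg.2 hc) this]
    have hi2 : 0 < (a i - Y) * ∏ l ∈ Finset.univ.erase i,
        (if l = k then t * a k - a i else 1) := by
      refine pos_mul_prod_of (fun l hl => ?_) (hA i)
      by_cases h2 : l = k
      · subst h2
        exact ⟨1, one_pos, by rw [if_pos hki, if_pos rfl]; ring⟩
      by_cases h3 : l < i
      · have hlk : l < k := by
          have e1 := Fin.lt_def.1 h3
          have e3 : (l : ℕ) ≠ k := fun h => h2 (Fin.ext h)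
          exact Fin.lt_def.2 (by omega)
        have := hsmall l hlk
        exact ⟨t * a l - a i, by linarith, by rw [if_pos h3, if_neg h2]; ring⟩
      · exact ⟨1, one_pos, by rw [if_neg h3, if_neg h2]; ring⟩
    rw [Finset.prod_ite_eq', if_pos (Finset.mem_erase.2 ⟨hki.ne, Finset.mem_univ _⟩)] at hi2
    nlinarith

/-- Indices at distance at least two contribute positive factors, so the condition at `j` reduces to
its immediate predecessor. The gap now follows once `Y < a_j` is known. -/
theorem pos_mul_gap (ha : StrictAnti a) (ht : 0 < t)
    (hA : ∀ j, 0 < (a j - Y) *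
      ∏ l ∈ Finset.univ.erase j, (if l < j then t * a l - a j else 1))
    (i j : Fin n) (hij : (i : ℕ) + 1 = j) : 0 < (a j - Y) * (t * a i - a j) := by
  have hi : i < j := Fin.lt_def.2 (by omega)
  have hj2 : 0 < (a j - Y) * ∏ l ∈ Finset.univ.erase j,
      (if l = i then t * a i - a j else 1) := by
    refine pos_mul_prod_of (fun l hl => ?_) (hA j)
    by_cases h2 : l = i
    · subst h2
      exact ⟨1, one_pos, by rw [if_pos hi, if_pos rfl]; ring⟩
    by_cases h3 : l < j
    · have := gap_of_add_two_le ha ht hA l j (by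
        have e1 := Fin.lt_def.1 h3
        have e3 : (l : ℕ) ≠ i := fun h => h2 (Fin.ext h)
        omega)
      exact ⟨t * a l - a j, by linarith, by rw [if_pos h3, if_neg h2]; ring⟩
    · exact ⟨1, one_pos, by rw [if_neg h3, if_neg h2]; ring⟩
  rwa [Finset.prod_ite_eq', if_pos (Finset.mem_erase.2 ⟨hi.ne, Finset.mem_univ _⟩)] at hj2

theorem gaps_of_weight_pos (ha : StrictAnti a) (h1 : ∀ j, 1 < a j) (ht : 0 < t) (ht1 : t < 1)
    (hpos : ∀ b : Idx n, 0 < (recipExt a b - Y) * ∏ c ∈ Finset.univ.erase b,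
      (recipExt a b * recipExt a c - t) / (recipExt a b - recipExt a c)) :
    (∀ i j : Fin n, (i : ℕ) + 1 = j → a j < t * a i) ∧ ∀ j, Y < a j ∧ (a j)⁻¹ < Y := by
  have hA := pos_of_weight_inl ha h1 ht ht1 hpos
  have hB := pos_of_weight_inr h1 ht1 hpos
  have hgap2 := gap_of_add_two_le ha ht hA
  have hgap := pos_mul_gap ha ht hA
  -- The `a_j` decrease, so both bounds on `Y` need proof only at the last index `p`.
  have key : ∀ p : Fin n, (p : ℕ) + 1 = n → Y < a p ∧ (a p)⁻¹ < Y := by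
    intro p hp
    by_cases hp0 : (p : ℕ) = 0
    · have hnl : ∀ l : Fin n, l = p := fun l => Fin.ext (by omega)
      have he : Finset.univ.erase p = ∅ :=
        Finset.eq_empty_of_forall_notMem fun l hl => Finset.ne_of_mem_erase hl (hnl l)
      have e1 := hA p
      have e2 := hB p
      rw [he, Finset.prod_empty, mul_one] at e1 e2
      exact ⟨by linarith, by linarith⟩
    let m : Fin n := ⟨(p : ℕ) - 1, by omega⟩
    have hm : (m : ℕ) + 1 = p := by simp [m]; omega
    have hmp : m < p := Fin.lt_def.2 (by omega)
    have hamp := ha hmp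
    have hp1 := h1 p
    have hm1 := h1 m
    -- The reciprocal condition at `p`: for `l` before `m = p - 1`, the gap at distance two gives `t
    -- a_p a_l > a_p² > 1`, so only the factor of `m` is undecided.
    have hBp : 0 < (Y - (a p)⁻¹) * (t * a p * a m - 1) := by
      have : 0 < (Y - (a p)⁻¹) * ∏ l ∈ Finset.univ.erase p,
          (if l = m then t * a p * a m - 1 else 1) := by
        refine pos_mul_prod_of (fun l hl => ?_) (hB p)
        have hlp := Finset.ne_of_mem_erase hl
        have hlt : l < p := by
          have : (l : ℕ) ≠ p := fun h => hlp (Fin.ext h)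
          exact Fin.lt_def.2 (by omega)
        have h2 := ha hlt
        have h3 : t * a p < a l := by nlinarith
        have h4 : a p - a l ≠ 0 := by linarith
        have h5 : a l - a p ≠ 0 := by linarith
        by_cases hlm : l = m
        · subst hlm
          refine ⟨(a m - t * a p) / (a m - a p), div_pos (by linarith) (by linarith), ?_⟩
          rw [if_pos rfl]
          field_simp
          ring
        · have h6 := hgap2 l p (by
            have e1 := Fin.lt_def.1 hlt
            have e3 : (l : ℕ) ≠ m := fun h => hlm (Fin.ext h)
            omega)
          refine ⟨_, ?_, by rw [if_neg hlm, mul_one]⟩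
          rw [mul_comm (a l - _), mul_div_assoc]
          refine mul_pos_of_neg_of_neg (by nlinarith) (div_neg_of_pos_of_neg (by linarith)
            (by linarith))
      rwa [Finset.prod_ite_eq', if_pos (Finset.mem_erase.2 ⟨hmp.ne, Finset.mem_univ _⟩)] at this
    -- The reciprocal condition at `m`: once `t a_m a_p > 1`, all factors with `l < m` are positive
    -- and only that of `p` remains.
    have hBm : 0 < (Y - (a m)⁻¹) * ((a p - t * a m) * (1 - t * a m * a p)) ∨
        t * a m * a p ≤ 1 := by
      by_cases hc : t * a m * a p ≤ 1
      · exact Or.inr hc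
      push Not at hc
      left
      have : 0 < (Y - (a m)⁻¹) * ∏ l ∈ Finset.univ.erase m,
          (if l = p then (a p - t * a m) * (1 - t * a m * a p) else 1) := by
        refine pos_mul_prod_of (fun l hl => ?_) (hB m)
        have hlm := Finset.ne_of_mem_erase hl
        by_cases hlp : l = p
        · subst hlp
          refine ⟨1 / (a m - a l), div_pos one_pos (by linarith), ?_⟩
          rw [if_pos rfl]
          ring
        · have hlt : l < m := by
            have e1 : (l : ℕ) ≠ p := fun h => hlp (Fin.ext h)
            have e3 : (l : ℕ) ≠ m := fun h => hlm (Fin.ext h)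
            exact Fin.lt_def.2 (by omega)
          have h2 := ha hlt
          refine ⟨_, ?_, by rw [if_neg hlp, mul_one]⟩
          rw [mul_comm (a l - _), mul_div_assoc]
          have h7 : t * a m * a p < t * a m * a l :=
            mul_lt_mul_of_pos_left (by linarith) (mul_pos ht (by linarith))
          refine mul_pos_of_neg_of_neg (by linarith) (div_neg_of_pos_of_neg (by nlinarith)
            (by linarith))
      rwa [Finset.prod_ite_eq', if_pos (Finset.mem_erase.2 ⟨hmp.ne', Finset.mem_univ _⟩)] at this
    have hg := hgap m p hm
    have hinv : (a p)⁻¹ < 1 := inv_lt_one_of_one_lt₀ hp1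
    have hinvm : (a m)⁻¹ < 1 := inv_lt_one_of_one_lt₀ hm1
    -- If `Y ≥ a_p`, then `hBp` gives `t a_m a_p > 1` and `hg` gives `t a_m < a_p`, so the product
    -- in `hBm` would be negative.
    have hYp : Y < a p := by
      by_contra hc
      push Not at hc
      have e1 : 1 < t * a m * a p := by
        have := (pos_iff_pos_of_mul_pos hBp).1 (by linarith)
        linarith
      have e2 : t * a m - a p < 0 := by
        by_contra h
        push Not at h
        nlinarith
      rcases hBm with h | h
      · have := (pos_iff_pos_of_mul_pos h).1 (by linarith)
        nlinarith
      · linarith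
    refine ⟨hYp, ?_⟩
    have e2 := (pos_iff_pos_of_mul_pos hg).1 (by linarith)
    have e3 : 0 < t * a p * a m - 1 := by nlinarith
    have := (pos_iff_pos_of_mul_pos hBp).2 e3
    linarith
  have hall : ∀ j, Y < a j ∧ (a j)⁻¹ < Y := by
    intro j
    have hj := j.2
    let p : Fin n := ⟨n - 1, by omega⟩
    obtain ⟨k1, k2⟩ := key p (by simp [p]; omega)
    have hle : a p ≤ a j := ha.antitone (Fin.le_def.2 (by simp [p]; omega))
    exact ⟨by linarith, (inv_anti₀ (by linarith [h1 p]) hle).trans_lt k2⟩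
  refine ⟨fun i j hij => ?_, hall⟩
  have := (pos_iff_pos_of_mul_pos (hgap i j hij)).1 (by linarith [(hall j).1])
  linarith

end Signs

end Weights

/-! ### Diagonalisation on the gauge slice and the trace formula for `Φ₁` -/

section Slice

variable {n : ℕ}

theorem one_lt_of_max_lt {x Λ : ℝ} (hx : 0 < x) (h : max (x ^ 2) (x ^ 2)⁻¹ < Λ) : 1 < Λ := by
  have h1 := (le_max_left _ _).trans_lt h
  have h2 := (le_max_right _ _).trans_lt h
  have hx2 : 0 < x ^ 2 := by positivity
  rcases le_total 1 (x ^ 2) with h3 | h3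
  · linarith
  · have := one_le_inv_iff₀.2 ⟨hx2, h3⟩
    linarith

variable {x : ℝ} {lam : Fin n → ℝ}

theorem gammaOf_sq (hx : 0 < x) (h : ∀ i, max (x ^ 2) (x ^ 2)⁻¹ < Lam lam i) (i : Fin n) :
    gammaOf x lam i ^ 2 = (Lam lam i - (x ^ 2)⁻¹) / (Lam lam i - (Lam lam i)⁻¹) := by
  have h1 := one_lt_of_max_lt hx (h i)
  have h2 := inv_lt_one_of_one_lt₀ h1
  have h3 := (le_max_right _ _).trans_lt (h i)
  exact Real.sq_sqrt (div_nonneg (by linarith) (by linarith))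

theorem sigmaOf_sq (hx : 0 < x) (h : ∀ i, max (x ^ 2) (x ^ 2)⁻¹ < Lam lam i) (i : Fin n) :
    sigmaOf x lam i ^ 2 = ((x ^ 2)⁻¹ - (Lam lam i)⁻¹) / (Lam lam i - (Lam lam i)⁻¹) := by
  have h1 := one_lt_of_max_lt hx (h i)
  have h2 := inv_lt_one_of_one_lt₀ h1
  have h3 := inv_strictAnti₀ (by positivity) ((le_max_left _ _).trans_lt (h i))
  exact Real.sq_sqrt (div_nonneg (by linarith) (by linarith))

theorem gammaOf_sq_add_sigmaOf_sq (hx : 0 < x)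
    (h : ∀ i, max (x ^ 2) (x ^ 2)⁻¹ < Lam lam i) (i : Fin n) :
    gammaOf x lam i * gammaOf x lam i + sigmaOf x lam i * sigmaOf x lam i = 1 := by
  have h1 := one_lt_of_max_lt hx (h i)
  have h2 := inv_lt_one_of_one_lt₀ h1
  rw [← sq, ← sq, gammaOf_sq hx h, sigmaOf_sq hx h, ← add_div, div_eq_one_iff_eq (by linarith)]
  ring

/-- The radicand factors as `x² (Λ - x⁻²)(x⁻² - Λ⁻¹)`, the product of the numerators of `Γ²` and
`Σ²`. -/
theorem betaOf_radicand_eq (hx : 0 < x) (h : ∀ i, max (x ^ 2) (x ^ 2)⁻¹ < Lam lam i) (i : Fin n) :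
    Lam lam i + (Lam lam i)⁻¹ - x ^ 2 - (x ^ 2)⁻¹ =
      (x * gammaOf x lam i * sigmaOf x lam i * (Lam lam i - (Lam lam i)⁻¹)) ^ 2 := by
  have h1 := one_lt_of_max_lt hx (h i)
  have h2 := inv_lt_one_of_one_lt₀ h1
  have hD : Lam lam i - (Lam lam i)⁻¹ ≠ 0 := by linarith
  have hL : Lam lam i ≠ 0 := by linarith
  rw [mul_pow, mul_pow, mul_pow, gammaOf_sq hx h, sigmaOf_sq hx h]
  generalize hDe : Lam lam i - (Lam lam i)⁻¹ = D at *
  field_simp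
  ring

theorem betaOf_eq (hx : 0 < x) (h : ∀ i, max (x ^ 2) (x ^ 2)⁻¹ < Lam lam i) (i : Fin n) :
    betaOf x lam i =
      x * gammaOf x lam i * sigmaOf x lam i * (Lam lam i - (Lam lam i)⁻¹) := by
  have h1 := one_lt_of_max_lt hx (h i)
  have h2 := inv_lt_one_of_one_lt₀ h1
  rw [betaOf, betaOf_radicand_eq hx h, Real.sqrt_sq]
  exact mul_nonneg (mul_nonneg (mul_nonneg hx.le (Real.sqrt_nonneg _)) (Real.sqrt_nonneg _))
    (by linarith)

theorem betaOf_mul_self (hx : 0 < x) (h : ∀ i, max (x ^ 2) (x ^ 2)⁻¹ < Lam lam i) (i : Fin n) :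
    betaOf x lam i * betaOf x lam i = Lam lam i + (Lam lam i)⁻¹ - x ^ 2 - (x ^ 2)⁻¹ :=
  Real.mul_self_sqrt (by rw [betaOf_radicand_eq hx h]; positivity)

theorem rho_conjTranspose : (rho x lam)ᴴ = rho x lam := by
  have h (f : Fin n → ℝ) : star (fun i => (f i : ℂ)) = fun i => (f i : ℂ) := by
    funext i; simp
  rw [rho, fromBlocks_conjTranspose, conjTranspose_neg, diagonal_conjTranspose,
    diagonal_conjTranspose, h, h]

theorem rho_mul_rho (hx : 0 < x) (h : ∀ i, max (x ^ 2) (x ^ 2)⁻¹ < Lam lam i) :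
    rho x lam * rho x lam = 1 := by
  have e1 : ∀ i, (gammaOf x lam i : ℂ) * gammaOf x lam i + sigmaOf x lam i * sigmaOf x lam i =
      1 := fun i => by exact_mod_cast gammaOf_sq_add_sigmaOf_sq hx h i
  rw [rho, fromBlocks_multiply, ← fromBlocks_one, ← diagonal_one, ← diagonal_zero]
  simp only [diagonal_mul_diagonal, diagonal_add, diagonal_neg]
  congr 2 <;> funext i
  · exact e1 i
  · ring
  · ring
  · rw [neg_mul_neg, add_comm]; exact e1 i

theorem gram_fromBlocks {y : ℂ} (hy : star y = y) (σ X : Matrix (Fin n) (Fin n) ℂ) :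
    fromBlocks (y⁻¹ • σ) X 0 (y • 1) * (fromBlocks (y⁻¹ • σ) X 0 (y • 1))ᴴ =
      gramLeft y (σ * σᴴ) X := by
  rw [fromBlocks_conjTranspose, fromBlocks_multiply, gramLeft]
  simp only [conjTranspose_smul, conjTranspose_zero, conjTranspose_one, star_inv₀, hy,
    Matrix.smul_mul, Matrix.mul_smul, smul_smul, Matrix.mul_one, Matrix.one_mul, Matrix.zero_mul,
    Matrix.mul_zero, zero_add, smul_zero]
  rw [sq, mul_inv]

/-- The matrix splits into `2 × 2` blocks of determinant `1` and trace `Λ_i + Λ_i⁻¹`, with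
eigenvectors `(Γ_i, Σ_i)` and `(Σ_i, -Γ_i)`. In `key`, `D` is the difference `Λ_i - Λ_i⁻¹` of the
eigenvalues. -/
theorem gramLeft_mul_rho (hx : 0 < x) (h : ∀ i, max (x ^ 2) (x ^ 2)⁻¹ < Lam lam i) :
    gramLeft (x : ℂ)⁻¹ 1 (diagonal fun i => (betaOf x lam i : ℂ)) * rho x lam =
      rho x lam * diagonal fun a => (recipExt (Lam lam) a : ℂ) := by
  have hdiag : (diagonal fun a => (recipExt (Lam lam) a : ℂ)) =
      fromBlocks (diagonal fun i => (Lam lam i : ℂ)) 0 0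
        (diagonal fun i => ((Lam lam i : ℂ))⁻¹) := by
    rw [fromBlocks_diagonal]
    congr 1
    funext a
    rcases a with i | i <;> simp [recipExt]
  have hst : star (fun i => (betaOf x lam i : ℂ)) = fun i => (betaOf x lam i : ℂ) := by
    funext i; simp
  rw [hdiag, gramLeft, rho, fromBlocks_multiply, fromBlocks_multiply, diagonal_conjTranspose, hst]
  simp only [← diagonal_one, ← diagonal_smul,
    diagonal_mul_diagonal, diagonal_add, diagonal_neg, Matrix.mul_zero, add_zero, zero_add]
  have hx0 : x ≠ 0 := hx.ne'
  have key : ∀ i, ∃ D : ℝ, x⁻¹ * betaOf x lam i = gammaOf x lam i * sigmaOf x lam i * D ∧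
      (x⁻¹ ^ 2)⁻¹ + betaOf x lam i * betaOf x lam i =
        Lam lam i + (Lam lam i)⁻¹ - x⁻¹ ^ 2 ∧
      gammaOf x lam i ^ 2 * D = Lam lam i - x⁻¹ ^ 2 ∧
      sigmaOf x lam i ^ 2 * D = x⁻¹ ^ 2 - (Lam lam i)⁻¹ := by
    intro i
    have h1 := one_lt_of_max_lt hx (h i)
    have h2 := inv_lt_one_of_one_lt₀ h1
    have hD : Lam lam i - (Lam lam i)⁻¹ ≠ 0 := by linarith
    refine ⟨Lam lam i - (Lam lam i)⁻¹, ?_, ?_, ?_, ?_⟩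
    · rw [betaOf_eq hx h, mul_assoc x, mul_assoc x, inv_mul_cancel_left₀ hx0]
    · rw [betaOf_mul_self hx h, inv_pow, inv_inv]
      ring
    · rw [gammaOf_sq hx h, div_mul_cancel₀ _ hD, inv_pow]
    · rw [sigmaOf_sq hx h, div_mul_cancel₀ _ hD, inv_pow]
  congr 2 <;> funext i <;> obtain ⟨D, hβ, hββ, hg, hs⟩ := key i <;>
    simp only [Pi.smul_apply, smul_eq_mul, mul_one] <;> norm_cast
  · linear_combination
      gammaOf x lam i * hββ + sigmaOf x lam i * hβ + gammaOf x lam i * hs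
  · linear_combination
      sigmaOf x lam i * hββ - gammaOf x lam i * hβ - sigmaOf x lam i * hg
  · linear_combination gammaOf x lam i * hβ + sigmaOf x lam i * hg
  · linear_combination sigmaOf x lam i * hβ + gammaOf x lam i * hs

/-- The value of the trace of a product of two projections of rank `N` which satisfy quadratic
relations with the same matrix. -/
theorem trace_mul_of_relations {ι : Type*} [Fintype ι] [DecidableEq ι] {Ω P Q V : Matrix ι ι ℂ}
    {a b t N : ℂ} (hQ : Ω * Q * Ω = a • Ω - t • (1 - Q) - V) (hP : Ω * P * Ω = b • Ω - (1 - P))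
    (hΩP : (Ω * P).trace = N * b) (hΩQ : (Ω * Q).trace = N * a) (htP : P.trace = N)
    (htQ : Q.trace = N) : (1 - t) * (N - (Q * P).trace) = (V * P).trace := by
  have h1 := congrArg (fun A => (A * P).trace) hQ
  have h2 := congrArg (fun A => (Q * A).trace) hP
  simp only [Matrix.sub_mul, Matrix.mul_sub, Matrix.smul_mul, Matrix.mul_smul, trace_sub,
    trace_smul, Matrix.one_mul, Matrix.mul_one, smul_eq_mul] at h1 h2
  -- By cyclicity, the relation for `Q` multiplied by `P` and the relation for `P` multiplied by `Q`
  -- have the same trace on the left; the terms `tr(QP)` enter with weights `t` and `1`.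
  have h3 : (Ω * Q * Ω * P).trace = (Q * (Ω * P * Ω)).trace := by
    rw [Matrix.trace_mul_comm Q]
    simp only [Matrix.mul_assoc]
    rw [Matrix.trace_mul_comm Ω]
    simp only [Matrix.mul_assoc]
    rw [Matrix.trace_mul_comm Q]
    simp only [Matrix.mul_assoc]
  rw [Matrix.trace_mul_comm Q Ω, hΩQ] at h2
  rw [h3, h2, hΩP, htP] at h1
  rw [htQ] at h1
  linear_combination -h1

theorem trace_gramLeft_mul_projTwo (y : ℂ) (S X : Matrix (Fin n) (Fin n) ℂ) :
    (gramLeft y S X * projTwo n).trace = n * y ^ 2 := by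
  rw [gramLeft, projTwo, fromBlocks_multiply, Matrix.trace, Fintype.sum_sum_type]
  simp

theorem trace_projTwo : (projTwo n).trace = n := by
  rw [projTwo, Matrix.trace, Fintype.sum_sum_type]
  simp

theorem matI_eq : matI n = 1 - (2 : ℂ) • projTwo n := by
  rw [matI, projTwo, ← fromBlocks_one]
  ext (i | i) (j | j) <;> simp [one_apply]
  split_ifs <;> norm_num

theorem exists_bL_gram {y : ℝ} {σ : Matrix (Fin n) (Fin n) ℂ} {g : Phase n}
    (h1 : (mat (bL g)).toBlocks₁₁ = (y : ℂ)⁻¹ • σ)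
    (h2 : (mat (bL g)).toBlocks₂₂ = (y : ℂ) • (1 : Matrix (Fin n) (Fin n) ℂ)) :
    ∃ X, mat g * (mat g)ᴴ = gramLeft (y : ℂ) (σ * σᴴ) X := by
  refine ⟨(mat (bL g)).toBlocks₁₂, ?_⟩
  obtain ⟨k, hk, hg⟩ := exists_bL_mul g
  have hk' : mat k * (mat k)ᴴ = 1 := mul_eq_one_comm.1 hk
  have hb : mat (bL g) = fromBlocks ((y : ℂ)⁻¹ • σ) (mat (bL g)).toBlocks₁₂ 0 ((y : ℂ) • 1) := by
    rw [← h1, ← h2]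
    ext (i | i) (j | j)
    · rfl
    · rfl
    · exact (isB_bL g).lower_block i j
    · rfl
  rw [← gram_fromBlocks (Complex.conj_ofReal y), ← hb]
  conv_lhs => rw [← hg]
  rw [mat_mul, conjTranspose_mul, Matrix.mul_assoc, ← Matrix.mul_assoc (mat k), hk',
    Matrix.one_mul]

/-- The Hamiltonian `Φ₁` and the squared moduli of the components of `w̃` on the gauge slice. -/
theorem slice_relations {y t : ℝ} (hx : 0 < x) (hy : 0 < y)
    {vhat : Fin n → ℂ} {σ : Matrix (Fin n) (Fin n) ℂ} {θ : Fin n → ℝ}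
    (hσσ : σ * σᴴ = (t : ℂ) • (1 : Matrix (Fin n) (Fin n) ℂ) + vecMulVec vhat (star vhat))
    {g : Phase n} (hg : g ∈ M0 x y σ) (hs : SliceCoords x vhat g lam θ) :
    (∀ z : ℝ, (z ^ 2 - t) * ∑ b, ‖wTilde x vhat lam g b‖ ^ 2 *
        ∏ c ∈ Finset.univ.erase b, (z * recipExt (Lam lam) c - t) =
      (z * y ^ 2 - t) *
        (∏ c, (z * recipExt (Lam lam) c - t) - t ^ n * ∏ c, (z - recipExt (Lam lam) c))) ∧
    (∀ a, recipExt (Lam lam) a ^ 2 = t →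
      ‖wTilde x vhat lam g a‖ ^ 2 = y ^ 2 * recipExt (Lam lam) a - t) ∧
    (1 - (t : ℂ)) * (n - Phi 1 g) = 2 * ∑ j, wMap vhat g (Sum.inr j) *
      star (wMap vhat g (Sum.inr j)) := by
  obtain ⟨X, hX⟩ := exists_bL_gram hg.2.2.1 hg.2.2.2
  have hmax := hs.max_lt
  have hΛ1 : ∀ i, 1 < Lam lam i := fun i => one_lt_of_max_lt hx (hmax i)
  have hyc : (y : ℂ) ≠ 0 := by exact_mod_cast hy.ne'
  set k := mat (kL g) with hk
  have hkk : kᴴ * k = 1 := kL_mem g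
  have hkk' : k * kᴴ = 1 := mul_eq_one_comm.1 hkk
  set Ω := gramLeft (x : ℂ)⁻¹ 1 (diagonal fun i => (betaOf x lam i : ℂ)) with hΩ
  have hbb : mat (bR g) * (mat (bR g))ᴴ = Ω := by
    have := gram_fromBlocks (y := (x : ℂ)⁻¹) (by rw [star_inv₀, Complex.star_def, Complex.conj_ofReal])
      1 (diagonal fun i => (betaOf x lam i : ℂ))
    rw [inv_inv, conjTranspose_one, Matrix.mul_one] at this
    rw [hs.bR_eq, this]
  have hM : mat g * (mat g)ᴴ = k * Ω * kᴴ := by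
    conv_lhs => rw [← kL_mul_bR g]
    rw [mat_mul, conjTranspose_mul, ← hbb]
    simp only [Matrix.mul_assoc, hk]
  have hΩM : kᴴ * gramLeft (y : ℂ) (σ * σᴴ) X * k = Ω := by
    rw [← hX, hM]
    calc kᴴ * (k * Ω * kᴴ) * k = (kᴴ * k) * Ω * (kᴴ * k) := by simp only [Matrix.mul_assoc]
      _ = Ω := by rw [hkk, Matrix.one_mul, Matrix.mul_one]
  set M := gramLeft (y : ℂ) (σ * σᴴ) X with hMdef
  have hρ := rho_mul_rho hx hmax
  have hρΩ : rho x lam * Ω * rho x lam = diagonal fun a => (recipExt (Lam lam) a : ℂ) := by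
    rw [Matrix.mul_assoc, gramLeft_mul_rho hx hmax, ← Matrix.mul_assoc, hρ, Matrix.one_mul]
  set U := rho x lam * kᴴ with hU
  have hUH : Uᴴ = k * rho x lam := by
    rw [hU, conjTranspose_mul, conjTranspose_conjTranspose, rho_conjTranspose]
  have hUU : Uᴴ * U = 1 := by
    rw [hUH, hU]
    calc k * rho x lam * (rho x lam * kᴴ) = k * (rho x lam * rho x lam) * kᴴ := by
          simp only [Matrix.mul_assoc]
      _ = 1 := by rw [hρ, Matrix.mul_one, hkk']
  have hUM : U * M * Uᴴ = diagonal fun a => (recipExt (Lam lam) a : ℂ) := by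
    rw [← hρΩ, hUH, hU, ← hΩM]
    simp only [Matrix.mul_assoc]
  have hw : wTilde x vhat lam g = U *ᵥ wHat vhat := by
    rw [wTilde, wMap, Matrix.mulVec_mulVec]
  have hL0 : ∀ a, (recipExt (Lam lam) a : ℂ) ≠ 0 := fun a => by
    exact_mod_cast (recipExt_pos hΛ1 a).ne'
  have hnorm : ∀ z : ℂ, z * star z = ((‖z‖ ^ 2 : ℝ) : ℂ) := fun z => by
    rw [Complex.star_def, Complex.mul_conj, Complex.normSq_eq_norm_sq]
  have hMPM := gramLeft_mul_projTwo (y : ℂ) t hyc vhat (σ * σᴴ) X hσσ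
  refine ⟨fun z => ?_, fun a ha => ?_, ?_⟩
  · have := sum_normSq_resolvent (y : ℂ) t hyc vhat (σ * σᴴ) X hσσ hL0 hUU hUM z
    rw [← hw] at this
    simp_rw [hnorm] at this
    exact_mod_cast this
  · have hUU' : U * Uᴴ = 1 := mul_eq_one_comm.1 hUU
    have h1 : diagonal (fun a => (recipExt (Lam lam) a : ℂ)) * (U * projTwo n * Uᴴ) *
        diagonal (fun a => (recipExt (Lam lam) a : ℂ)) = U * (M * projTwo n * M) * Uᴴ := by
      rw [← hUM]
      calc U * M * Uᴴ * (U * projTwo n * Uᴴ) * (U * M * Uᴴ)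
          = U * M * (Uᴴ * U) * projTwo n * (Uᴴ * U) * M * Uᴴ := by simp only [Matrix.mul_assoc]
        _ = U * (M * projTwo n * M) * Uᴴ := by
          rw [hUU, Matrix.mul_one, Matrix.mul_one]; simp only [Matrix.mul_assoc]
    rw [hMPM] at h1
    have h2 : U * ((y : ℂ) ^ 2 • M - (t : ℂ) • (1 - projTwo n) -
        vecMulVec (wHat vhat) (star (wHat vhat))) * Uᴴ =
        (y : ℂ) ^ 2 • diagonal (fun a => (recipExt (Lam lam) a : ℂ)) -
        (t : ℂ) • (1 - U * projTwo n * Uᴴ) -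
        vecMulVec (wTilde x vhat lam g) (star (wTilde x vhat lam g)) := by
      rw [← hUM, hw, star_mulVec]
      simp only [Matrix.mul_sub, Matrix.sub_mul, Matrix.mul_smul, Matrix.smul_mul, Matrix.mul_one,
        hUU', mul_vecMulVec, vecMulVec_mul]
    rw [h2] at h1
    have h3 := congrFun (congrFun h1 a) a
    simp only [diagonal_mul, mul_diagonal, Matrix.sub_apply, Matrix.smul_apply, diagonal_apply_eq,
      one_apply_eq, vecMulVec_apply, Pi.star_apply, smul_eq_mul, hnorm] at h3
    have ha' : (recipExt (Lam lam) a : ℂ) ^ 2 = t := by exact_mod_cast ha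
    -- The unknown diagonal entry of `U P U†` appears with `L_a²` on one side and `t` on the other,
    -- hence drops out exactly in the degenerate case.
    have h4 : ((‖wTilde x vhat lam g a‖ ^ 2 : ℝ) : ℂ) =
        ((y ^ 2 * recipExt (Lam lam) a - t : ℝ) : ℂ) := by
      push_cast at h3 ⊢
      linear_combination h3 - (U * projTwo n * Uᴴ) a a * ha'
    exact_mod_cast h4
  -- `Ω` is itself a Gram matrix of the same form, with `y` replaced by `x⁻¹`, `t` by `1` and `v̂`
  -- by `0`; this is the relation for `P`.
  · have hΩPΩ := gramLeft_mul_projTwo (x : ℂ)⁻¹ 1 (inv_ne_zero (by exact_mod_cast hx.ne')) 0 1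
      (diagonal fun i => (betaOf x lam i : ℂ)) (by simp)
    rw [← hΩ, one_smul, show wHat (0 : Fin n → ℂ) = 0 by funext a; rcases a with i | i <;> rfl,
      zero_vecMulVec, sub_zero] at hΩPΩ
    have hQ : Ω * (kᴴ * projTwo n * k) * Ω = (y : ℂ) ^ 2 • Ω -
        (t : ℂ) • (1 - kᴴ * projTwo n * k) -
        vecMulVec (wMap vhat g) (star (wMap vhat g)) := by
      have h1 : Ω * (kᴴ * projTwo n * k) * Ω = kᴴ * (M * projTwo n * M) * k := by
        rw [← hΩM]
        calc kᴴ * M * k * (kᴴ * projTwo n * k) * (kᴴ * M * k)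
            = kᴴ * M * (k * kᴴ) * projTwo n * (k * kᴴ) * M * k := by simp only [Matrix.mul_assoc]
          _ = kᴴ * (M * projTwo n * M) * k := by
            rw [hkk', Matrix.mul_one, Matrix.mul_one]; simp only [Matrix.mul_assoc]
      rw [h1, hMPM, ← hΩM, wMap, ← hk, star_mulVec, conjTranspose_conjTranspose]
      simp only [Matrix.mul_sub, Matrix.sub_mul, Matrix.mul_smul, Matrix.smul_mul, Matrix.mul_one,
        hkk, mul_vecMulVec, vecMulVec_mul, ← hMdef]
    have htQ : (kᴴ * projTwo n * k).trace = n := by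
      rw [Matrix.trace_mul_comm, ← Matrix.mul_assoc, hkk', Matrix.one_mul, trace_projTwo]
    have hΩQ : (Ω * (kᴴ * projTwo n * k)).trace = n * (y : ℂ) ^ 2 := by
      rw [← trace_gramLeft_mul_projTwo (y : ℂ) (σ * σᴴ) X, ← hMdef, ← hΩM]
      have : kᴴ * M * k * (kᴴ * projTwo n * k) = kᴴ * (M * (k * kᴴ) * projTwo n * k) := by
        simp only [Matrix.mul_assoc]
      rw [this, hkk', Matrix.mul_one, Matrix.trace_mul_comm, Matrix.mul_assoc, hkk',
        Matrix.mul_one]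
    have htr := trace_mul_of_relations hQ hΩPΩ (trace_gramLeft_mul_projTwo _ _ _) hΩQ
      trace_projTwo htQ
    have hPhi : Phi 1 g = 2 * (kᴴ * projTwo n * k * projTwo n).trace - n := by
      -- Substitution of `I = 1 - 2P` in `k† I k I`.
      have e : matL g = 1 - (2 : ℂ) • projTwo n - (2 : ℂ) • (kᴴ * projTwo n * k) +
          (4 : ℂ) • (kᴴ * projTwo n * k * projTwo n) := by
        rw [matL, ← hk, matI_eq]
        simp only [Matrix.mul_sub, Matrix.sub_mul, Matrix.mul_smul, Matrix.smul_mul,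
          Matrix.mul_one, Matrix.one_mul, hkk, smul_sub, smul_smul]
        module
      rw [Phi, pow_one, e]
      simp only [trace_add, trace_sub, trace_smul, trace_one, trace_projTwo, htQ, Fintype.card_sum,
        Fintype.card_fin, smul_eq_mul]
      push_cast
      ring
    have hV : (vecMulVec (wMap vhat g) (star (wMap vhat g)) * projTwo n).trace =
        ∑ j, wMap vhat g (Sum.inr j) * star (wMap vhat g (Sum.inr j)) := by
      rw [trace_mul_vecMulVec, projTwo, dotProduct, Fintype.sum_sum_type]
      simp [fromBlocks_mulVec, mul_comm]
    rw [← hV, ← htr, hPhi]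
    ring

/-- As `ρ² = 1`, `w_{n+j} = Σ_j w̃_j - Γ_j w̃_{n+j}`. The cross terms of the squared modulus are
conjugate to each other, and the angle condition turns them into a cosine. -/
theorem wMap_inr_mul_star (hx : 0 < x) {vhat : Fin n → ℂ} {θ : Fin n → ℝ}
    {g : Phase n} (hs : SliceCoords x vhat g lam θ) (j : Fin n) :
    wMap vhat g (Sum.inr j) * star (wMap vhat g (Sum.inr j)) =
      ((sigmaOf x lam j ^ 2 * ‖wTilde x vhat lam g (Sum.inl j)‖ ^ 2 +
        gammaOf x lam j ^ 2 * ‖wTilde x vhat lam g (Sum.inr j)‖ ^ 2 -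
        2 * (sigmaOf x lam j * gammaOf x lam j * (‖wTilde x vhat lam g (Sum.inl j)‖ *
          ‖wTilde x vhat lam g (Sum.inr j)‖) * Real.cos (θ j)) : ℝ) : ℂ) := by
  have h1 : wMap vhat g = rho x lam *ᵥ wTilde x vhat lam g := by
    rw [wTilde, Matrix.mulVec_mulVec, rho_mul_rho hx hs.max_lt, Matrix.one_mulVec]
  have h2 : wMap vhat g (Sum.inr j) = sigmaOf x lam j * wTilde x vhat lam g (Sum.inl j) -
      gammaOf x lam j * wTilde x vhat lam g (Sum.inr j) := by
    rw [h1, rho, fromBlocks_mulVec, Sum.elim_inr, Pi.add_apply, mulVec_diagonal, neg_mulVec,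
      Pi.neg_apply, mulVec_diagonal]
    simp [sub_eq_add_neg]
  have hang := hs.angle j
  have hang' := congrArg star hang
  rw [h2]
  generalize wTilde x vhat lam g (Sum.inl j) = p at *
  generalize wTilde x vhat lam g (Sum.inr j) = q at *
  have hp : p * star p = (‖p‖ : ℂ) ^ 2 := by
    rw [Complex.star_def, Complex.mul_conj, Complex.normSq_eq_norm_sq]; push_cast; rfl
  have hq : q * star q = (‖q‖ : ℂ) ^ 2 := by
    rw [Complex.star_def, Complex.mul_conj, Complex.normSq_eq_norm_sq]; push_cast; rfl
  have hcos : 2 * (Real.cos (θ j) : ℂ) =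
      Complex.exp (Complex.I * θ j) + star (Complex.exp (Complex.I * θ j)) := by
    rw [Complex.star_def, ← Complex.exp_conj, map_mul, Complex.conj_I, Complex.conj_ofReal,
      Complex.ofReal_cos, Complex.cos, mul_comm Complex.I]
    ring_nf
  have hn : star ((‖p * q‖ : ℝ) : ℂ) = ((‖p * q‖ : ℝ) : ℂ) := Complex.conj_ofReal _
  rw [star_mul', star_mul', star_star, hn] at hang'
  have hG : star (gammaOf x lam j : ℂ) = gammaOf x lam j := Complex.conj_ofReal _
  have hS : star (sigmaOf x lam j : ℂ) = sigmaOf x lam j := Complex.conj_ofReal _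
  rw [star_sub, star_mul', star_mul', hG, hS]
  rw [norm_mul] at hang hang'
  push_cast at hang hang' hcos ⊢
  linear_combination (sigmaOf x lam j : ℂ) ^ 2 * hp + (gammaOf x lam j : ℂ) ^ 2 * hq -
    (sigmaOf x lam j : ℂ) * gammaOf x lam j * (hang + hang') +
    (sigmaOf x lam j : ℂ) * gammaOf x lam j * ‖p‖ * ‖q‖ * hcos

end Slice

/-! ### Translation into hyperbolic functions of `λ`, `u`, `v`, `μ` -/

section Hyperbolic

theorem sinh_sq_eq (z : ℝ) :
    Real.sinh z ^ 2 = (Real.exp (2 * z) - 1) ^ 2 / (4 * Real.exp (2 * z)) := by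
  have h := (Real.exp_pos z).ne'
  rw [Real.sinh_eq, Real.exp_neg, two_mul, Real.exp_add]
  field_simp
  norm_num

theorem cosh_sq_eq (z : ℝ) :
    Real.cosh z ^ 2 = (Real.exp (2 * z) + 1) ^ 2 / (4 * Real.exp (2 * z)) := by
  have h := (Real.exp_pos z).ne'
  rw [Real.cosh_eq, Real.exp_neg, two_mul, Real.exp_add]
  field_simp
  norm_num

theorem sinh_sq_eq_of_inv {μ t : ℝ} (ht : t = Real.exp (-μ) ^ 2) :
    Real.sinh μ ^ 2 = (1 - t) ^ 2 / (4 * t) := by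
  have h := (Real.exp_pos μ).ne'
  rw [ht, Real.sinh_eq, Real.exp_neg]
  field_simp
  norm_num

theorem one_sub_sinh_sq_div_nonneg {a b : ℝ} (h : |a| ≤ |b|) :
    0 ≤ 1 - Real.sinh a ^ 2 / Real.sinh b ^ 2 := by
  have h1 : Real.sinh a ^ 2 ≤ Real.sinh b ^ 2 := by
    rw [sq_le_sq, Real.abs_sinh, Real.abs_sinh]
    exact Real.sinh_le_sinh.2 h
  linarith [div_le_one_of_le₀ h1 (sq_nonneg _)]

variable {n : ℕ} {u v μ t : ℝ} {lam : Fin n → ℝ}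

/-- The factors at `Λ_k` and `Λ_k⁻¹` multiply to `t` times one hyperbolic factor. This is the
product of `sum_weight_div` at `ε = 1`; `prod_cosh_factor` is its analogue at `ε = -1`. -/
theorem prod_sinh_factor (ht : t = Real.exp (-μ) ^ 2) (h1 : ∀ j, 1 < Lam lam j) :
    ∏ c, (1 * t - recipExt (Lam lam) c) / (1 - recipExt (Lam lam) c) =
      t ^ n * ∏ k, (1 - Real.sinh μ ^ 2 / Real.sinh (lam k) ^ 2) := by
  have ht0 : t ≠ 0 := by rw [ht]; positivity
  rw [Fintype.prod_sum_type, ← Finset.prod_mul_distrib]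
  have hc : t ^ n = ∏ _k : Fin n, t := by simp
  rw [hc, ← Finset.prod_mul_distrib]
  refine Finset.prod_congr rfl fun k _ => ?_
  have hk := h1 k
  rw [sinh_sq_eq_of_inv ht, sinh_sq_eq, ← Lam]
  simp only [recipExt, Sum.elim_inl, Sum.elim_inr]
  generalize Lam lam k = Λ at *
  have h2 : Λ ≠ 0 := by linarith
  have h3 : 1 - Λ ≠ 0 := by linarith
  have h4 : Λ - 1 ≠ 0 := by linarith
  have h5 : 1 - Λ⁻¹ = (Λ - 1) / Λ := by field_simp
  rw [h5]
  field_simp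
  ring

theorem prod_cosh_factor (ht : t = Real.exp (-μ) ^ 2) (h1 : ∀ j, 1 < Lam lam j) :
    ∏ c, (-1 * t - recipExt (Lam lam) c) / (-1 - recipExt (Lam lam) c) =
      t ^ n * ∏ k, (1 + Real.sinh μ ^ 2 / Real.cosh (lam k) ^ 2) := by
  have ht0 : t ≠ 0 := by rw [ht]; positivity
  rw [Fintype.prod_sum_type, ← Finset.prod_mul_distrib]
  have hc : t ^ n = ∏ _k : Fin n, t := by simp
  rw [hc, ← Finset.prod_mul_distrib]
  refine Finset.prod_congr rfl fun k _ => ?_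
  have hk := h1 k
  rw [sinh_sq_eq_of_inv ht, cosh_sq_eq, ← Lam]
  simp only [recipExt, Sum.elim_inl, Sum.elim_inr]
  generalize Lam lam k = Λ at *
  have h2 : Λ ≠ 0 := by linarith
  have h3 : -1 - Λ ≠ 0 := by linarith
  have h4 : Λ + 1 ≠ 0 := by linarith
  have h5 : -1 - Λ⁻¹ = -(Λ + 1) / Λ := by field_simp; ring
  have h6 : -1 - Λ = -(Λ + 1) := by ring
  rw [h5, h6]
  field_simp
  ring

/-- The part of the Hamiltonian that does not depend on the angles. -/
theorem potV_eq (hμ : 0 < μ) (ht : t = Real.exp (-μ) ^ 2) (h1 : ∀ j, 1 < Lam lam j)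
    {W : Idx n → ℝ}
    (hgen : ∀ z : ℝ, (z ^ 2 - t) * ∑ b, W b *
        ∏ c ∈ Finset.univ.erase b, (z * recipExt (Lam lam) c - t) =
      (z * Real.exp (-u) ^ 2 - t) *
        (∏ c, (z * recipExt (Lam lam) c - t) - t ^ n * ∏ c, (z - recipExt (Lam lam) c))) :
    (1 - t) * (n - potV u v μ lam) = 2 * ∑ a, W a *
      (((Real.exp (-v) ^ 2)⁻¹ * recipExt (Lam lam) a - 1) / (recipExt (Lam lam) a ^ 2 - 1)) := by
  have ht0 : 0 < t := by rw [ht]; positivity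
  have ht1 : t < 1 := by
    rw [ht, ← Real.exp_nat_mul]
    exact Real.exp_lt_one_iff.2 (by push_cast; linarith)
  have hcard : Fintype.card (Idx n) = 2 * n := by
    rw [Fintype.card_sum, Fintype.card_fin, two_mul]
  have hLp := recipExt_pos h1
  have hL1 : ∀ a, 1 - recipExt (Lam lam) a ≠ 0 := by
    rintro (j | j) <;> simp only [recipExt, Sum.elim_inl, Sum.elim_inr]
    · linarith [h1 j]
    · linarith [inv_lt_one_of_one_lt₀ (h1 j)]
  have hL2 : ∀ a, -1 - recipExt (Lam lam) a ≠ 0 := fun a => by linarith [hLp a]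
  have e1 := sum_weight_div hcard ht0.ne' (one_pow 2) hL1 hgen
  have e2 := sum_weight_div hcard ht0.ne' (by norm_num) hL2 hgen
  rw [prod_sinh_factor ht h1, mul_div_cancel_left₀ _ (pow_ne_zero _ ht0.ne')] at e1
  rw [prod_cosh_factor ht h1, mul_div_cancel_left₀ _ (pow_ne_zero _ ht0.ne')] at e2
  set p := (Real.exp (-v) ^ 2)⁻¹ with hp
  -- Partial fractions: the poles at `1` and `-1` are exactly the two sums computed in `e1` and
  -- `e2`, and they produce the sinh and cosh products of `V`.
  have e3 : 2 * ∑ a, W a * ((p * recipExt (Lam lam) a - 1) / (recipExt (Lam lam) a ^ 2 - 1)) =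
      (p - 1) * ∑ a, W a / (recipExt (Lam lam) a - 1) +
        (p + 1) * ∑ a, W a / (recipExt (Lam lam) a - -1) := by
    rw [Finset.mul_sum, Finset.mul_sum, Finset.mul_sum, ← Finset.sum_add_distrib]
    refine Finset.sum_congr rfl fun a _ => ?_
    have f1 : recipExt (Lam lam) a - 1 ≠ 0 := fun h => hL1 a (by linarith)
    have f2 : recipExt (Lam lam) a + 1 ≠ 0 := fun h => hL2 a (by linarith)
    have f3 : recipExt (Lam lam) a ^ 2 - 1 =
      (recipExt (Lam lam) a - 1) * (recipExt (Lam lam) a + 1) := by ring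
    rw [f3, sub_neg_eq_add]
    field_simp
    ring
  have hs : Real.sinh μ ^ 2 = (1 - t) ^ 2 / (4 * t) := sinh_sq_eq_of_inv ht
  have g0 : Real.exp (v - u) * Real.exp (u - v) = 1 := by
    rw [← Real.exp_add]; simp
  have g1 : (p - 1) * (Real.exp (-u) ^ 2 - 1) =
      -4 * (Real.exp (v - u) * (Real.sinh v * Real.sinh u)) := by
    have := (Real.exp_pos u).ne'
    have := (Real.exp_pos v).ne'
    rw [hp, Real.sinh_eq, Real.sinh_eq, Real.exp_sub, Real.exp_neg, Real.exp_neg]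
    field_simp
    ring
  have g2 : (p + 1) * (Real.exp (-u) ^ 2 + 1) =
      4 * (Real.exp (v - u) * (Real.cosh v * Real.cosh u)) := by
    have := (Real.exp_pos u).ne'
    have := (Real.exp_pos v).ne'
    rw [hp, Real.cosh_eq, Real.cosh_eq, Real.exp_sub, Real.exp_neg, Real.exp_neg]
    field_simp
    ring
  have ht' : 1 - t ≠ 0 := by linarith
  have ht'' : t - 1 ≠ 0 := by linarith
  have hq : (Real.sinh μ ^ 2)⁻¹ * (1 - t) ^ 2 = 4 * t := by
    rw [hs]
    field_simp
  rw [e3, potV, constC, Real.cosh_sub]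
  simp only [div_eq_mul_inv (_ * _) (Real.sinh μ ^ 2), div_eq_mul_inv (_ - _) (Real.sinh μ ^ 2)]
  generalize ∏ k, (1 - Real.sinh μ ^ 2 / Real.sinh (lam k) ^ 2) = P1 at *
  generalize ∏ k, (1 + Real.sinh μ ^ 2 / Real.cosh (lam k) ^ 2) = P2 at *
  generalize ∑ a, W a / (recipExt (Lam lam) a - 1) = T1 at *
  generalize ∑ a, W a / (recipExt (Lam lam) a - -1) = T2 at *
  refine mul_left_cancel₀ ht'' ?_
  linear_combination (1 - t) ^ 2 * n * g0 + Real.exp (v - u) *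
    (Real.sinh v * Real.sinh u * P1 - Real.cosh v * Real.cosh u * P2 +
      Real.cosh v * Real.cosh u - Real.sinh v * Real.sinh u) * hq -
    (p - 1) * e1 - (p + 1) * e2 - t * (1 - P1) * g1 - t * (1 - P2) * g2

/-- The interaction of `k` and `l` in the product of the weights at `Λ_k` and `Λ_k⁻¹`; neither
weight alone has this symmetric form. -/
theorem prod_weight_factor {a b t' : ℝ} (ht : t' = Real.exp (-μ) ^ 2) (ha : 0 < a) (hb : 0 < b)
    (hab : a ≠ b) :
    (Real.exp (2 * a) * Real.exp (2 * b) - t') / (Real.exp (2 * a) - Real.exp (2 * b)) *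
        ((Real.exp (2 * a) * (Real.exp (2 * b))⁻¹ - t') /
          (Real.exp (2 * a) - (Real.exp (2 * b))⁻¹)) *
      (((Real.exp (2 * a))⁻¹ * Real.exp (2 * b) - t') /
          ((Real.exp (2 * a))⁻¹ - Real.exp (2 * b)) *
        (((Real.exp (2 * a))⁻¹ * (Real.exp (2 * b))⁻¹ - t') /
          ((Real.exp (2 * a))⁻¹ - (Real.exp (2 * b))⁻¹))) =
      t' ^ 2 * ((1 - Real.sinh μ ^ 2 / Real.sinh (a - b) ^ 2) *
        (1 - Real.sinh μ ^ 2 / Real.sinh (a + b) ^ 2)) := by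
  have ht0 : t' ≠ 0 := by rw [ht]; positivity
  have hA : 1 < Real.exp (2 * a) := Real.one_lt_exp_iff.2 (by linarith)
  have hB : 1 < Real.exp (2 * b) := Real.one_lt_exp_iff.2 (by linarith)
  have hAB : Real.exp (2 * a) ≠ Real.exp (2 * b) := fun h => hab (by
    have := Real.exp_injective h
    linarith)
  rw [sinh_sq_eq_of_inv ht, sinh_sq_eq (a - b), sinh_sq_eq (a + b), mul_sub 2, mul_add 2, Real.exp_sub,
    Real.exp_add]
  generalize Real.exp (2 * a) = A at *
  generalize Real.exp (2 * b) = B at *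
  have h1 : A ≠ 0 := by linarith
  have h2 : B ≠ 0 := by linarith
  have h3 : A - B ≠ 0 := sub_ne_zero.2 hAB
  have h4 : A * B - 1 ≠ 0 := by nlinarith
  have e1 : A - B⁻¹ = (A * B - 1) / B := by field_simp
  have e2 : A⁻¹ - B = -(A * B - 1) / A := by field_simp; ring
  have e3 : A⁻¹ - B⁻¹ = -(A - B) / (A * B) := by field_simp; ring
  have e4 : A / B - 1 = (A - B) / B := by field_simp
  rw [e1, e2, e3, e4]
  field_simp
  ring

/-- Serves both external parameters: `z = v` for `Γ² Σ²`, and `z = -u` for the one-body part of the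
product of two weights. -/
theorem sinh_ratio_factor {a : ℝ} (ha : 0 < a) (z : ℝ) :
    (Real.exp (2 * a) - Real.exp (2 * z)) * ((Real.exp (2 * a))⁻¹ - Real.exp (2 * z)) /
        ((Real.exp (2 * a) - (Real.exp (2 * a))⁻¹) * ((Real.exp (2 * a))⁻¹ - Real.exp (2 * a))) =
      Real.exp z ^ 2 * (1 - Real.sinh z ^ 2 / Real.sinh a ^ 2) / (4 * Real.cosh a ^ 2) := by
  have hA : 1 < Real.exp (2 * a) := Real.one_lt_exp_iff.2 (by linarith)
  have hz : Real.exp z ^ 2 = Real.exp (2 * z) := by rw [← Real.exp_nat_mul]; norm_num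
  have hZ := (Real.exp_pos (2 * z)).ne'
  rw [sinh_sq_eq, sinh_sq_eq, cosh_sq_eq, hz]
  generalize Real.exp (2 * a) = A at *
  generalize Real.exp (2 * z) = Z at *
  have h1 : A ≠ 0 := by linarith
  have h2 : A - 1 ≠ 0 := by linarith
  have h3 : A + 1 ≠ 0 := by linarith
  have e1 : A - A⁻¹ = (A - 1) * (A + 1) / A := by field_simp; ring
  have e2 : A⁻¹ - A = -((A - 1) * (A + 1)) / A := by field_simp; ring
  rw [e1, e2]
  field_simp
  ring

theorem gammaOf_mul_sigmaOf_sq {k : Fin n} (hpos : 0 < lam k)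
    (h : ∀ i, max (Real.exp (-v) ^ 2) (Real.exp (-v) ^ 2)⁻¹ < Lam lam i) :
    sigmaOf (Real.exp (-v)) lam k ^ 2 * gammaOf (Real.exp (-v)) lam k ^ 2 =
      Real.exp v ^ 2 * (1 - Real.sinh v ^ 2 / Real.sinh (lam k) ^ 2) /
        (4 * Real.cosh (lam k) ^ 2) := by
  have hz : (Real.exp (-v) ^ 2)⁻¹ = Real.exp (2 * v) := by
    rw [← Real.exp_nat_mul, ← Real.exp_neg]
    push_cast
    ring_nf
  rw [← sinh_ratio_factor hpos, gammaOf_sq (Real.exp_pos _) h, sigmaOf_sq (Real.exp_pos _) h, hz,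
    Lam, div_mul_div_comm, ← neg_sub (Real.exp (2 * lam k)) (Real.exp (2 * lam k))⁻¹, mul_neg,
    div_neg, ← neg_div, ← neg_sub (Real.exp (2 * lam k))⁻¹ (Real.exp (2 * v))]
  ring

theorem weight_mul_weight (ht : t = Real.exp (-μ) ^ 2) (hpos : ∀ i, 0 < lam i)
    (hinj : Function.Injective lam) {W : Idx n → ℝ}
    (hW : ∀ b, t ^ n * W b = t * (recipExt (Lam lam) b - Real.exp (-u) ^ 2) *
      ∏ c ∈ Finset.univ.erase b, (recipExt (Lam lam) b * recipExt (Lam lam) c - t) /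
        (recipExt (Lam lam) b - recipExt (Lam lam) c)) (k : Fin n) :
    W (Sum.inl k) * W (Sum.inr k) = (1 - t) ^ 2 *
      (Real.exp (-u) ^ 2 * (1 - Real.sinh u ^ 2 / Real.sinh (lam k) ^ 2) /
        (4 * Real.cosh (lam k) ^ 2)) *
      ∏ l ∈ Finset.univ.erase k, ((1 - Real.sinh μ ^ 2 / Real.sinh (lam k - lam l) ^ 2) *
        (1 - Real.sinh μ ^ 2 / Real.sinh (lam k + lam l) ^ 2)) := by
  have ht0 : t ≠ 0 := by rw [ht]; positivity
  have h1 := hW (Sum.inl k)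
  have h2 := hW (Sum.inr k)
  rw [prod_erase_inl] at h1
  rw [prod_erase_inr] at h2
  simp only [recipExt, Sum.elim_inl, Sum.elim_inr, Lam] at h1 h2
  have h3 := prod_weight_factor ht (hpos k) (hpos k)
  have hprod : (∏ l ∈ Finset.univ.erase k, ((Real.exp (2 * lam k) * Real.exp (2 * lam l) - t) /
        (Real.exp (2 * lam k) - Real.exp (2 * lam l)) *
      ((Real.exp (2 * lam k) * (Real.exp (2 * lam l))⁻¹ - t) /
        (Real.exp (2 * lam k) - (Real.exp (2 * lam l))⁻¹)))) *
      ∏ l ∈ Finset.univ.erase k, (((Real.exp (2 * lam k))⁻¹ * Real.exp (2 * lam l) - t) /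
        ((Real.exp (2 * lam k))⁻¹ - Real.exp (2 * lam l)) *
      (((Real.exp (2 * lam k))⁻¹ * (Real.exp (2 * lam l))⁻¹ - t) /
        ((Real.exp (2 * lam k))⁻¹ - (Real.exp (2 * lam l))⁻¹))) =
      (t ^ 2) ^ (n - 1) *
        ∏ l ∈ Finset.univ.erase k, ((1 - Real.sinh μ ^ 2 / Real.sinh (lam k - lam l) ^ 2) *
          (1 - Real.sinh μ ^ 2 / Real.sinh (lam k + lam l) ^ 2)) := by
    have hcard : (Finset.univ.erase k).card = n - 1 := by
      rw [Finset.card_erase_of_mem (Finset.mem_univ k), Finset.card_univ, Fintype.card_fin]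
    rw [← Finset.prod_mul_distrib, ← hcard, ← Finset.prod_const, ← Finset.prod_mul_distrib]
    refine Finset.prod_congr rfl fun l hl => ?_
    exact prod_weight_factor ht (hpos k) (hpos l)
      fun h => Finset.ne_of_mem_erase hl (hinj h).symm
  have hu := sinh_ratio_factor (hpos k) (-u)
  rw [Real.sinh_neg, neg_sq] at hu
  rw [← hu]
  have hz : Real.exp (-u) ^ 2 = Real.exp (2 * -u) := by rw [← Real.exp_nat_mul]; norm_num
  rw [hz] at h1 h2
  have hA : 1 < Real.exp (2 * lam k) := Real.one_lt_exp_iff.2 (by linarith [hpos k])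
  have hA1 := inv_lt_one_of_one_lt₀ hA
  rw [mul_inv_cancel₀ (by linarith)] at h1
  rw [inv_mul_cancel₀ (by linarith)] at h2
  -- Each of the `n - 1` pairs contributes `t²`, and the prefactors `t` of the two weights give the
  -- last one. The subtraction is harmless since `k : Fin n` forces `n ≥ 1`.
  have hpow : t ^ n * t ^ n = t ^ 2 * (t ^ 2) ^ (n - 1) := by
    have hk := k.2
    rw [← pow_succ', ← pow_mul, ← pow_add]
    congr 1
    omega
  refine mul_left_cancel₀ (mul_ne_zero (pow_ne_zero n ht0) (pow_ne_zero n ht0)) ?_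
  have h4 : t ^ n * t ^ n * (W (Sum.inl k) * W (Sum.inr k)) =
      (t ^ n * W (Sum.inl k)) * (t ^ n * W (Sum.inr k)) := by ring
  rw [h4, h1, h2, hpow]
  generalize (t ^ 2) ^ (n - 1) = T at *
  have hsub : Real.exp (2 * lam k) - (Real.exp (2 * lam k))⁻¹ ≠ 0 := by linarith
  have hsub' : (Real.exp (2 * lam k))⁻¹ - Real.exp (2 * lam k) ≠ 0 := by linarith
  rw [← div_mul_div_comm]
  generalize Real.exp (2 * lam k) - (Real.exp (2 * lam k))⁻¹ = d at *
  generalize (Real.exp (2 * lam k))⁻¹ - Real.exp (2 * lam k) = d' at *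
  linear_combination t ^ 2 * (Real.exp (2 * lam k) - Real.exp (2 * -u)) *
    ((Real.exp (2 * lam k))⁻¹ - Real.exp (2 * -u)) * ((1 - t) / d) * ((1 - t) / d') * hprod

/-- The coefficient of `cos θ_k`. -/
theorem cos_coeff_eq (hμ : 0 < μ) (ht : t = Real.exp (-μ) ^ 2)
    (hx : ∀ i, max (Real.exp (-v) ^ 2) (Real.exp (-v) ^ 2)⁻¹ < Lam lam i)
    (hlam : ∀ i, max |v| |u| < lam i) (hgap : ∀ k l, k ≠ l → μ < |lam k - lam l|) {r : Idx n → ℝ}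
    (hr : ∀ a, 0 ≤ r a)
    (hW : ∀ b, t ^ n * r b ^ 2 = t * (recipExt (Lam lam) b - Real.exp (-u) ^ 2) *
      ∏ c ∈ Finset.univ.erase b, (recipExt (Lam lam) b * recipExt (Lam lam) c - t) /
        (recipExt (Lam lam) b - recipExt (Lam lam) c)) (k : Fin n) :
    4 * (sigmaOf (Real.exp (-v)) lam k * gammaOf (Real.exp (-v)) lam k *
        (r (Sum.inl k) * r (Sum.inr k))) =
      (1 - t) * (Real.exp (v - u) * (1 / Real.cosh (lam k) ^ 2 *
        Real.sqrt (1 - Real.sinh v ^ 2 / Real.sinh (lam k) ^ 2) *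
        Real.sqrt (1 - Real.sinh u ^ 2 / Real.sinh (lam k) ^ 2) *
        ∏ l ∈ Finset.univ.erase k,
          (Real.sqrt (1 - Real.sinh μ ^ 2 / Real.sinh (lam k - lam l) ^ 2) *
            Real.sqrt (1 - Real.sinh μ ^ 2 / Real.sinh (lam k + lam l) ^ 2)))) := by
  have hpos : ∀ i, 0 < lam i := fun i =>
    ((abs_nonneg v).trans (le_max_left _ _)).trans_lt (hlam i)
  have hinj : Function.Injective lam := by
    intro i j hij
    by_contra h
    have := hgap i j h
    rw [hij, sub_self, abs_zero] at this
    linarith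
  have ht1 : t < 1 := by
    rw [ht, ← Real.exp_nat_mul]
    exact Real.exp_lt_one_iff.2 (by push_cast; linarith)
  have hA : 0 ≤ 1 - Real.sinh v ^ 2 / Real.sinh (lam k) ^ 2 := one_sub_sinh_sq_div_nonneg
    (((le_max_left _ _).trans (hlam k).le).trans (le_abs_self _))
  have hB : 0 ≤ 1 - Real.sinh u ^ 2 / Real.sinh (lam k) ^ 2 := one_sub_sinh_sq_div_nonneg
    (((le_max_right _ _).trans (hlam k).le).trans (le_abs_self _))
  have hC : ∀ l ∈ Finset.univ.erase k,
      0 ≤ 1 - Real.sinh μ ^ 2 / Real.sinh (lam k - lam l) ^ 2 := fun l hl =>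
    one_sub_sinh_sq_div_nonneg (by
      rw [abs_of_pos hμ]
      exact (hgap k l (Finset.ne_of_mem_erase hl).symm).le)
  have hD : ∀ l ∈ Finset.univ.erase k,
      0 ≤ 1 - Real.sinh μ ^ 2 / Real.sinh (lam k + lam l) ^ 2 := fun l hl =>
    one_sub_sinh_sq_div_nonneg (by
      rw [abs_of_pos hμ]
      -- For positive `λ`, `|λ_k - λ_l| ≤ λ_k + λ_l`, so the gap bounds the sums too.
      refine ((hgap k l (Finset.ne_of_mem_erase hl).symm).le).trans (abs_le_abs ?_ ?_) <;>
        linarith [hpos k, hpos l])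
  have hprod : (∏ l ∈ Finset.univ.erase k,
      (Real.sqrt (1 - Real.sinh μ ^ 2 / Real.sinh (lam k - lam l) ^ 2) *
        Real.sqrt (1 - Real.sinh μ ^ 2 / Real.sinh (lam k + lam l) ^ 2))) ^ 2 =
      ∏ l ∈ Finset.univ.erase k, ((1 - Real.sinh μ ^ 2 / Real.sinh (lam k - lam l) ^ 2) *
        (1 - Real.sinh μ ^ 2 / Real.sinh (lam k + lam l) ^ 2)) := by
    rw [← Finset.prod_pow]
    refine Finset.prod_congr rfl fun l hl => ?_
    rw [mul_pow, Real.sq_sqrt (hC l hl), Real.sq_sqrt (hD l hl)]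
  -- Both sides are nonnegative, so it suffices to compare squares, where all roots disappear.
  rw [← sq_eq_sq₀]
  · have e1 := gammaOf_mul_sigmaOf_sq (hpos k) hx
    have e2 := weight_mul_weight (W := fun a => r a ^ 2) ht hpos hinj hW k
    have e3 : Real.exp (v - u) = Real.exp v * Real.exp (-u) := by
      rw [← Real.exp_add, sub_eq_add_neg]
    have hc := (Real.cosh_pos (lam k)).ne'
    rw [← hprod] at e2
    have hA' := Real.sq_sqrt hA
    have hB' := Real.sq_sqrt hB
    rw [← hA'] at e1
    rw [← hB'] at e2
    have e4 : (4 * (sigmaOf (Real.exp (-v)) lam k * gammaOf (Real.exp (-v)) lam k *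
        (r (Sum.inl k) * r (Sum.inr k)))) ^ 2 =
        16 * (sigmaOf (Real.exp (-v)) lam k ^ 2 * gammaOf (Real.exp (-v)) lam k ^ 2) *
        (r (Sum.inl k) ^ 2 * r (Sum.inr k) ^ 2) := by ring
    rw [e4, e1, e2, e3]
    field_simp
    ring
  · exact mul_nonneg (by norm_num) (mul_nonneg (mul_nonneg (Real.sqrt_nonneg _)
      (Real.sqrt_nonneg _)) (mul_nonneg (hr _) (hr _)))
  · exact mul_nonneg (by linarith) (by positivity)

end Hyperbolic

/-! ### The polyhedron and the assembly of the Hamiltonian -/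

section Main

variable {n : ℕ} {u v μ : ℝ} {lam : Fin n → ℝ}

theorem mem_polyhedron_of_gaps (hlam : StrictAnti lam)
    (hx : ∀ i, max (Real.exp (-v) ^ 2) (Real.exp (-v) ^ 2)⁻¹ < Lam lam i)
    (hgap : ∀ i j : Fin n, (i : ℕ) + 1 = j → Lam lam j < Real.exp (-μ) ^ 2 * Lam lam i)
    (hu : ∀ j, Real.exp (-u) ^ 2 < Lam lam j ∧ (Lam lam j)⁻¹ < Real.exp (-u) ^ 2) :
    lam ∈ polyhedron n u v μ := by
  have hsq : ∀ z : ℝ, Real.exp z ^ 2 = Real.exp (2 * z) := fun z => by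
    rw [← Real.exp_nat_mul]; norm_num
  simp only [Lam, hsq, ← Real.exp_neg, ← Real.exp_add, Real.exp_lt_exp, max_lt_iff] at hx hgap hu
  refine ⟨hlam, fun i => max_lt (abs_lt.2 ⟨?_, ?_⟩) (abs_lt.2 ⟨?_, ?_⟩), fun i j hij => ?_⟩
  · linarith [(hx i).1]
  · linarith [(hx i).2]
  · linarith [(hu i).1]
  · linarith [(hu i).2]
  · linarith [hgap i j hij]

theorem lt_abs_sub_of_mem_polyhedron (h : lam ∈ polyhedron n u v μ) {k l : Fin n} (hkl : k ≠ l) :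
    μ < |lam k - lam l| := by
  have hlt : ∀ k l : Fin n, k < l → μ < lam k - lam l := by
    intro k l hkl
    have hk := Fin.lt_def.1 hkl
    have h1 := h.2.2 k ⟨k + 1, by omega⟩ rfl
    have h2 : lam l ≤ lam ⟨k + 1, by omega⟩ := h.1.antitone (Fin.le_def.2 (by simp; omega))
    linarith
  rcases lt_or_gt_of_ne hkl with h1 | h1
  · exact (hlt k l h1).trans_le (le_abs_self _)
  · rw [abs_sub_comm]
    exact (hlt l k h1).trans_le (le_abs_self _)

/-- The single rational function `(x⁻² L - 1) / (L² - 1)` takes the value `Σ_j²` at `L = Λ_j` and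
`Γ_j²` at `L = Λ_j⁻¹`. This brings the angle-free part into the form needed by `potV_eq`. -/
theorem sum_sigma_gamma_weight {x : ℝ} (hx : 0 < x)
    (h : ∀ i, max (x ^ 2) (x ^ 2)⁻¹ < Lam lam i) (W : Idx n → ℝ) :
    ∑ a, W a * (((x ^ 2)⁻¹ * recipExt (Lam lam) a - 1) / (recipExt (Lam lam) a ^ 2 - 1)) =
      ∑ j, (sigmaOf x lam j ^ 2 * W (Sum.inl j) + gammaOf x lam j ^ 2 * W (Sum.inr j)) := by
  rw [Fintype.sum_sum_type, ← Finset.sum_add_distrib]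
  refine Finset.sum_congr rfl fun j _ => ?_
  have hj := one_lt_of_max_lt hx (h j)
  rw [gammaOf_sq hx h, sigmaOf_sq hx h]
  simp only [recipExt, Sum.elim_inl, Sum.elim_inr]
  generalize (x ^ 2)⁻¹ = p
  generalize Lam lam j = Λ at *
  have h1 : Λ ≠ 0 := by linarith
  have h2 : Λ ^ 2 - 1 ≠ 0 := by nlinarith
  have e1 : Λ - Λ⁻¹ = (Λ ^ 2 - 1) / Λ := by field_simp
  have e2 : Λ⁻¹ ^ 2 - 1 = -(Λ ^ 2 - 1) / Λ ^ 2 := by field_simp; ring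
  rw [e1, e2]
  field_simp
  ring

end Main

end SU2n

theorem theorem3p3 (n : ℕ) (u v μ : ℝ) (hμ : 0 < μ)
    (vhat : Fin n → ℂ)
    (hvhat : ∑ i, ‖vhat i‖ ^ 2 =
      Real.exp (-μ) ^ 2 * ((Real.exp (-μ) ^ (2 * n))⁻¹ - 1))
    (σ : Matrix (Fin n) (Fin n) ℂ)
    (hσ : SU2n.IsPosUpper id σ)
    (hσσ : σ * σ.conjTranspose =
      ((Real.exp (-μ) ^ 2 : ℝ) : ℂ) • (1 : Matrix (Fin n) (Fin n) ℂ) +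
        Matrix.vecMulVec vhat (star vhat))
    (p : SU2n.MRed (Real.exp (-v)) (Real.exp (-u)) σ vhat)
    (lam θ : Fin n → ℝ) (hp : SU2n.HasCoords p lam θ) :
    lam ∈ SU2n.polyhedron n u v μ ∧
      SU2n.PhiRed 1 p = ((SU2n.hamRSvD u v μ lam θ : ℝ) : ℂ) := by
  obtain ⟨g, rfl, hs⟩ := hp
  obtain ⟨t, ht⟩ : ∃ t : ℝ, t = Real.exp (-μ) ^ 2 := ⟨_, rfl⟩
  have hx := Real.exp_pos (-v)
  have ht0 : 0 < t := by rw [ht]; positivity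
  have ht1 : t < 1 := by
    rw [ht, ← Real.exp_nat_mul]
    exact Real.exp_lt_one_iff.2 (by push_cast; linarith)
  rw [← ht] at hσσ
  obtain ⟨hgen, hdeg, hPhi⟩ := SU2n.slice_relations hx (Real.exp_pos (-u)) hσσ g.2 hs
  have hΛ1 : ∀ i, 1 < SU2n.Lam lam i := fun i => SU2n.one_lt_of_max_lt hx (hs.max_lt i)
  have hΛ : StrictAnti (SU2n.Lam lam) := fun i j hij =>
    Real.exp_lt_exp.2 (by linarith [hs.strictAnti hij])
  have hcard : Fintype.card (SU2n.Idx n) = 2 * n := by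
    rw [Fintype.card_sum, Fintype.card_fin, two_mul]
  have hW := SU2n.weight_eq hcard ht0.ne' (fun a => (SU2n.recipExt_pos hΛ1 a).ne')
    (SU2n.recipExt_injective hΛ hΛ1) hgen hdeg
  -- The nonvanishing of the components of `w̃` enters here, as strict positivity of the weights.
  obtain ⟨hgap, hu⟩ := SU2n.gaps_of_weight_pos (Y := Real.exp (-u) ^ 2) hΛ hΛ1 ht0 ht1
    (fun b => by
      have h1 : 0 < t ^ n * ‖SU2n.wTilde (Real.exp (-v)) vhat lam g b‖ ^ 2 :=
        mul_pos (pow_pos ht0 n) (pow_pos (norm_pos_iff.2 (hs.wTilde_ne b)) 2)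
      rw [hW b, mul_assoc] at h1
      exact (mul_pos_iff_of_pos_left ht0).1 h1)
  rw [ht] at hgap
  have hpoly := SU2n.mem_polyhedron_of_gaps hs.strictAnti hs.max_lt hgap hu
  refine ⟨hpoly, ?_⟩
  -- On an orbit the lifted function unfolds to its value at the chosen representative.
  change SU2n.Phi 1 (g : SU2n.Phase n) = _
  have hV := SU2n.potV_eq (v := v) hμ ht hΛ1 hgen
  rw [SU2n.sum_sigma_gamma_weight hx hs.max_lt] at hV
  have hcos := SU2n.cos_coeff_eq hμ ht hs.max_lt hpoly.2.1
    (fun k l hkl => SU2n.lt_abs_sub_of_mem_polyhedron hpoly hkl) (fun a => norm_nonneg _) hW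
  simp_rw [SU2n.wMap_inr_mul_star hx hs] at hPhi
  -- The real form of the trace formula: `hV` matches the angle-free terms and `hcos` the cosines,
  -- both carrying the common factor `1 - t ≠ 0` that is cancelled at the end.
  have hreal : (1 - t) * (n - SU2n.hamRSvD u v μ lam θ) =
      2 * ∑ j, (SU2n.sigmaOf (Real.exp (-v)) lam j ^ 2 *
          ‖SU2n.wTilde (Real.exp (-v)) vhat lam g (Sum.inl j)‖ ^ 2 +
        SU2n.gammaOf (Real.exp (-v)) lam j ^ 2 *
          ‖SU2n.wTilde (Real.exp (-v)) vhat lam g (Sum.inr j)‖ ^ 2 -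
        2 * (SU2n.sigmaOf (Real.exp (-v)) lam j * SU2n.gammaOf (Real.exp (-v)) lam j *
          (‖SU2n.wTilde (Real.exp (-v)) vhat lam g (Sum.inl j)‖ *
          ‖SU2n.wTilde (Real.exp (-v)) vhat lam g (Sum.inr j)‖) * Real.cos (θ j))) := by
    rw [Finset.sum_sub_distrib, mul_sub (2 : ℝ), ← hV, SU2n.hamRSvD]
    have hsum : 2 * ∑ j, 2 * (SU2n.sigmaOf (Real.exp (-v)) lam j *
          SU2n.gammaOf (Real.exp (-v)) lam j *
          (‖SU2n.wTilde (Real.exp (-v)) vhat lam g (Sum.inl j)‖ *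
          ‖SU2n.wTilde (Real.exp (-v)) vhat lam g (Sum.inr j)‖) * Real.cos (θ j)) =
        (1 - t) * (Real.exp (v - u) * ∑ k, Real.cos (θ k) / Real.cosh (lam k) ^ 2 *
          Real.sqrt (1 - Real.sinh v ^ 2 / Real.sinh (lam k) ^ 2) *
          Real.sqrt (1 - Real.sinh u ^ 2 / Real.sinh (lam k) ^ 2) *
          ∏ l ∈ Finset.univ.erase k,
            (Real.sqrt (1 - Real.sinh μ ^ 2 / Real.sinh (lam k - lam l) ^ 2) *
              Real.sqrt (1 - Real.sinh μ ^ 2 / Real.sinh (lam k + lam l) ^ 2))) := by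
      rw [Finset.mul_sum, Finset.mul_sum, Finset.mul_sum]
      refine Finset.sum_congr rfl fun k _ => ?_
      linear_combination Real.cos (θ k) * hcos k
    rw [hsum]
    ring
  have hfin : (1 - (t : ℂ)) * (n - SU2n.Phi 1 (g : SU2n.Phase n)) =
      (1 - (t : ℂ)) * (n - ((SU2n.hamRSvD u v μ lam θ : ℝ) : ℂ)) := by
    rw [hPhi]
    exact_mod_cast hreal.symm
  have h1t : (1 - (t : ℂ)) ≠ 0 := by
    have : (1 - t : ℝ) ≠ 0 := by linarith
    exact_mod_cast this
  exact sub_right_injective (mul_left_cancel₀ h1t hfin)
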